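/- Let $S$ be a left cancellative monoid with identity $e$. **Notation.** Let $I_\ell(S)$ be the left inverse hull of $S$, i.e. the inverse semigroup of partial bijections of $S$ generated by the left translations $t\mapsto st$, $s\in S$. Let $\mathcal J(S)$ be the set of constructible ideals, i.e. of the domains $X\subset S$ of the idempotents $p_X$ of $I_\ell(S)$, and let $\bar{\mathcal J}(S)$ be the set of all sets $X\setminus(X_1\cup\dots\cup X_m)$ with $m\ge 0$ and $X,X_1,\dots,X_m\in\mathcal J(S)$. Let $E(S)=\{p_X\mid X\in\mathcal J(S)\}$ be the semilattice of idempotents, and let $\widehat{E(S)}$ be the space of its semi-characters (semigroup homomorphisms $E(S)\to\{0,1\}$ that are not identically zero) with the topology of pointwise convergence. For $s\in S$ put $\chi_s(p_X)=\mathbf 1_X(s)$, and let $\Omega(S)$ be the closure of $\{\chi_s\mid s\in S\}$ in $\widehat{E(S)}$. Every $\chi\in\Omega(S)$ extends to $\bar{\mathcal J}(S)$: $\chi(p_{X\setminus(X_1\cup\dots\cup X_m)})=1$ if $\chi(p_X)=1$ and $\chi(p_{X_i})=0$ for all $i$, and it is $0$ otherwise. Let $\mathcal G(S)$ be Spielberg's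 groupoid: its elements are the classes $[g,\chi]$ of pairs $(g,\chi)\in I_\ell(S)\times\Omega(S)$ with $\chi(g^{-1}g)=1$, where $(g,\chi)\sim(h,\psi)$ iff $\chi=\psi$ and there is $A\in\bar{\mathcal J}(S)$ with $\chi(p_A)=1$ and $g|_A=h|_A$; the source of $[g,\chi]$ is $\chi$, its range is $\chi(g^{-1}\cdot g)$, the product is $[g,\chi][h,\psi]=[gh,\psi]$ when $\chi=\psi(h^{-1}\cdot h)$, the inverse is $[g,\chi]^{-1}=[g^{-1},\chi(g^{-1}\cdot g)]$, and a basis of the topology is given by the sets $D(g,U)=\{[g,\chi]\mid\chi\in U\}$ with $U$ an open subset of $\{\chi\in\Omega(S)\mid\chi(g^{-1}g)=1\}$. It is a locally compact, not necessarily Hausdorff, étale groupoid with unit space $\Omega(S)$. For such a groupoid $\mathcal G$, $C_c(\mathcal G)$ is the linear span of the spaces $C_c(V)$, extended by zero, over all open Hausdorff subsets $V\subset\mathcal G$. For a unit $x$ and $\mathcal G_x=s^{-1}(x)$, the representation $\rho_x$ of $C_c(\mathcal G)$ on $\ell^2(\mathcal G_x)$ is given by $(\rho_x(f)\xi)(g)=\sum_{h:\,r(h)=r(g)}f(h)\xi(h^{-1}g)$,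 and $C^*_r(\mathcal G)$ is the completion of $C_c(\mathcal G)$ in the norm $\|f\|_r=\sup_x\|\rho_x(f)\|$, to which each $\rho_x$ extends. Finally, $C^*_r(S)\subset B(\ell^2(S))$ is the C$^*$-algebra generated by the operators $\lambda_s$, $\lambda_s\delta_t=\delta_{st}$, $s\in S$. The monoid $S$ is called *C$^*$-regular* if, given $h_1,\dots,h_n\in I_\ell(S)$ and $X\in\bar{\mathcal J}(S)$ with $$\emptyset\ne X\subset\bigcup_{k=1}^n\{s\in S: h_ks=s\},$$ there are $Y_1,\dots,Y_l\in\bar{\mathcal J}(S)$ and indices $1\le k_j\le n$ ($1\le j\le l$) such that $$X\subset\bigcup_{j=1}^lY_j\qquad\text{and}\qquad h_{k_j}|_{Y_j}=\mathrm{id}\quad\text{for all }j.$$ **Proposition.** If $S$ is C$^*$-regular, then $\rho_{\chi_e}$ defines an isomorphism $C^*_r(\mathcal G(S))\cong C^*_r(S)$. More precisely, there is a (unique) unitary $U\colon\ell^2(S)\to\ell^2(\mathcal G(S)_{\chi_e})$ with $U\delta_s=\delta_{[s,\chi_e]}$ for all $s\in S$, where $s$ is viewed as the left translation by $s$ in $I_\ell(S)$,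 and $a\mapsto U^*\rho_{\chi_e}(a)U$ is a $*$-isomorphism of $C^*_r(\mathcal G(S))$ onto $C^*_r(S)$. -/

import Mathlib

open scoped ENNReal Topology

namespace SemigroupCStar

/-! ### Étale groupoids and their reduced C*-algebras -/

/-- A groupoid, given by its set `G` of arrows and its set `X` of units. The product `mul g h` is
the groupoid product when `src g = rng h`; its value on other pairs carries no information. -/
class ArrowGroupoid (G : Type*) (X : outParam Type*) where
  src : G → X
  rng : G → X
  unit : X → G
  inv : G → G
  mul : G → G → G
  src_unit : ∀ x, src (unit x) = x
  rng_unit : ∀ x, rng (unit x) = x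
  src_inv : ∀ g, src (inv g) = rng g
  rng_inv : ∀ g, rng (inv g) = src g
  src_mul : ∀ g h, src g = rng h → src (mul g h) = src h
  rng_mul : ∀ g h, src g = rng h → rng (mul g h) = rng g
  assoc : ∀ g h k, src g = rng h → src h = rng k → mul (mul g h) k = mul g (mul h k)
  unit_mul : ∀ g, mul (unit (rng g)) g = g
  mul_unit : ∀ g, mul g (unit (src g)) = g
  inverse_mul : ∀ g, mul (inv g) g = unit (src g)
  mul_inverse : ∀ g, mul g (inv g) = unit (rng g)

/-- A locally compact, not necessarily Hausdorff, étale groupoid: the operations are continuous,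
the unit space is locally compact Hausdorff in the relative topology, and the source and range maps
are local homeomorphisms (so that the arrow space is automatically locally compact). -/
class EtaleGroupoid (G : Type*) (X : outParam Type*) [TopologicalSpace G] [TopologicalSpace X]
    extends ArrowGroupoid G X where
  continuous_inv : Continuous inv
  continuous_mul : Continuous fun p : {p : G × G // src p.1 = rng p.2} => mul p.1.1 p.1.2
  unit_isEmbedding : Topology.IsEmbedding unit
  t2_units : T2Space X
  locallyCompact_units : LocallyCompactSpace X
  src_isLocalHomeomorph : IsLocalHomeomorph src
  rng_isLocalHomeomorph : IsLocalHomeomorph rng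

/-- The Hilbert space `ℓ²(ι)`. -/
abbrev L2 (ι : Type*) : Type _ := lp (fun _ : ι => ℂ) 2

open Classical in
/-- The basis vector `δ_i` of `ℓ²(ι)`. -/
noncomputable def delta {ι : Type*} (i : ι) : L2 ι := lp.single 2 i (1 : ℂ)

/-- A complex matrix whose entries are bounded and whose rows and columns have boundedly many
nonzero entries acts boundedly on `ℓ²`. -/
theorem kernel_sum_le {ι : Type*} (A : ι → ι → ℂ) (N : ℕ) (C : ℝ)
    (hA : ∀ i j, ‖A i j‖ ≤ C) (hrow : ∀ i, {j | A i j ≠ 0}.encard ≤ N)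
    (hcol : ∀ j, {i | A i j ≠ 0}.encard ≤ N) (ξ : L2 ι) (s : Finset ι) :
    ∑ i ∈ s, ‖∑' j, A i j * ξ j‖ ^ (2 : ℝ≥0∞).toReal
      ≤ ((N * C) * ‖ξ‖) ^ (2 : ℝ≥0∞).toReal := by
  classical
  simp only [ENNReal.toReal_ofNat, Real.rpow_two]
  have hfin : ∀ i, {j | A i j ≠ 0}.Finite := fun i =>
    Set.finite_of_encard_le_coe (hrow i)
  set R : ι → Finset ι := fun i => (hfin i).toFinset with hR
  have hmemR : ∀ i j, j ∈ R i ↔ A i j ≠ 0 := fun i j => by simp [hR]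
  have hcardR : ∀ i, (R i).card ≤ N := fun i => by
    have h1 := hrow i
    rw [(hfin i).encard_eq_coe_toFinset_card] at h1
    exact_mod_cast h1
  have htsum : ∀ i, ∑' j, A i j * ξ j = ∑ j ∈ R i, A i j * ξ j := fun i => by
    refine tsum_eq_sum fun j hj => ?_
    have : A i j = 0 := by
      by_contra h
      exact hj ((hmemR i j).2 h)
    simp [this]
  have hterm : ∀ i, ‖∑' j, A i j * ξ j‖ ^ 2 ≤ (N * C ^ 2) * ∑ j ∈ R i, ‖ξ j‖ ^ 2 := fun i => by
    rw [htsum]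
    calc ‖∑ j ∈ R i, A i j * ξ j‖ ^ 2 ≤ (∑ j ∈ R i, C * ‖ξ j‖) ^ 2 := by
          gcongr
          refine (norm_sum_le _ _).trans (Finset.sum_le_sum fun j _ => ?_)
          rw [norm_mul]
          gcongr
          exact hA i j
      _ ≤ (R i).card * ∑ j ∈ R i, (C * ‖ξ j‖) ^ 2 := sq_sum_le_card_mul_sum_sq
      _ ≤ N * ∑ j ∈ R i, (C * ‖ξ j‖) ^ 2 := by
          gcongr
          exact hcardR i
      _ = _ := by
          simp only [mul_pow, ← Finset.mul_sum]
          ring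
  have hcount : ∀ j, ((s.filter fun i => j ∈ R i).card : ℝ) ≤ N := fun j => by
    have h1 : ((s.filter fun i => j ∈ R i).card : ℕ∞) ≤ N := by
      rw [← Set.encard_coe_eq_coe_finsetCard]
      refine (Set.encard_le_encard ?_).trans (hcol j)
      intro i hi
      exact (hmemR i j).1 (Finset.mem_filter.1 hi).2
    exact_mod_cast h1
  calc ∑ i ∈ s, ‖∑' j, A i j * ξ j‖ ^ 2
      ≤ ∑ i ∈ s, (N * C ^ 2) * ∑ j ∈ R i, ‖ξ j‖ ^ 2 := Finset.sum_le_sum fun i _ => hterm i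
    _ = (N * C ^ 2) * ∑ i ∈ s, ∑ j ∈ R i, ‖ξ j‖ ^ 2 := by rw [Finset.mul_sum]
    _ = (N * C ^ 2) * ∑ j ∈ s.biUnion R, ∑ i ∈ s.filter (fun i => j ∈ R i), ‖ξ j‖ ^ 2 := by
        congr 1
        refine Finset.sum_comm' fun i j => ?_
        simp only [Finset.mem_filter, Finset.mem_biUnion]
        constructor
        · rintro ⟨h1, h2⟩
          exact ⟨⟨h1, h2⟩, i, h1, h2⟩
        · rintro ⟨h1, -⟩
          exact h1
    _ ≤ (N * C ^ 2) * ∑ j ∈ s.biUnion R, N * ‖ξ j‖ ^ 2 := by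
        gcongr with j _
        rw [Finset.sum_const, nsmul_eq_mul]
        exact mul_le_mul_of_nonneg_right (hcount j) (by positivity)
    _ = (N * C) ^ 2 * ∑ j ∈ s.biUnion R, ‖ξ j‖ ^ 2 := by
        rw [← Finset.mul_sum]
        ring
    _ ≤ (N * C) ^ 2 * ‖ξ‖ ^ 2 := by
        gcongr
        have := lp.sum_rpow_le_norm_rpow (p := 2) (by simp) ξ (s.biUnion R)
        simpa using this
    _ = _ := by ring

section General

variable {G X : Type*}

open ArrowGroupoid

/-- The set `G_x` of arrows with source `x`. -/
abbrev SrcFiber (G : Type*) {X : Type*} [ArrowGroupoid G X] (x : X) : Type _ :=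
  {g : G // src g = x}

/-- The set `G^x` of arrows with range `x`. -/
abbrev RngFiber (G : Type*) {X : Type*} [ArrowGroupoid G X] (x : X) : Type _ :=
  {g : G // rng g = x}

theorem src_inv_mul [ArrowGroupoid G X] {x : X} (g : SrcFiber G x) (h : RngFiber G (rng g.1)) :
    src (mul (inv h.1) g.1) = x := by
  rw [src_mul _ _ (by rw [src_inv, h.2]), g.2]

/-- The formula `∑_{h ∈ G^{r(g)}} f(h) ξ(h⁻¹g)`. -/
noncomputable def convFormula [ArrowGroupoid G X] (f : G → ℂ) (x : X) (ξ : SrcFiber G x → ℂ)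
    (g : SrcFiber G x) : ℂ :=
  ∑' h : RngFiber G (rng g.1), f h.1 * ξ ⟨mul (inv h.1) g.1, src_inv_mul g h⟩

/-- The bijection `G^{r(g)} → G_x`, `h ↦ h⁻¹g`, for `g ∈ G_x`. -/
def fiberEquiv [ArrowGroupoid G X] {x : X} (g : SrcFiber G x) :
    RngFiber G (rng g.1) ≃ SrcFiber G x where
  toFun h := ⟨mul (inv h.1) g.1, src_inv_mul g h⟩
  invFun k := ⟨mul g.1 (inv k.1), by rw [rng_mul _ _ (by rw [rng_inv, g.2, k.2])]⟩
  left_inv h := by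
    obtain ⟨h, hh⟩ := h
    obtain ⟨g, hg⟩ := g
    simp only [Subtype.mk.injEq] at hh ⊢
    have e1 : src (inv h) = rng g := by rw [src_inv, hh]
    have e2 : src g = rng (inv (mul (inv h) g)) := by rw [rng_inv, src_mul _ _ e1]
    calc mul g (inv (mul (inv h) g))
        = mul (mul (unit (rng g)) g) (inv (mul (inv h) g)) := by rw [unit_mul]
      _ = mul (mul (mul h (inv h)) g) (inv (mul (inv h) g)) := by rw [mul_inverse, hh]
      _ = mul (mul h (mul (inv h) g)) (inv (mul (inv h) g)) := by
          rw [assoc h (inv h) g (by rw [rng_inv]) e1]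
      _ = mul h (mul (mul (inv h) g) (inv (mul (inv h) g))) := by
          rw [assoc h _ _ (by rw [rng_mul _ _ e1, rng_inv]) (by rw [rng_inv])]
      _ = mul h (unit (src h)) := by rw [mul_inverse, rng_mul _ _ e1, rng_inv]
      _ = h := mul_unit h
  right_inv k := by
    obtain ⟨k, hk⟩ := k
    obtain ⟨g, hg⟩ := g
    simp only [Subtype.mk.injEq]
    have e1 : src g = rng (inv k) := by rw [rng_inv, hk, hg]
    have e3 : src (inv (mul g (inv k))) = rng g := by rw [src_inv, rng_mul _ _ e1]
    calc mul (inv (mul g (inv k))) g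
        = mul (inv (mul g (inv k))) (mul g (unit (src g))) := by rw [mul_unit]
      _ = mul (inv (mul g (inv k))) (mul g (mul (inv k) k)) := by rw [inverse_mul, hk, hg]
      _ = mul (inv (mul g (inv k))) (mul (mul g (inv k)) k) := by
          rw [assoc g (inv k) k e1 (src_inv k)]
      _ = mul (mul (inv (mul g (inv k))) (mul g (inv k))) k := by
          exact (assoc _ _ k (by rw [src_inv]) (by rw [src_mul _ _ e1, src_inv])).symm
      _ = mul (unit (rng k)) k := by rw [inverse_mul, src_mul _ _ e1, src_inv]
      _ = k := unit_mul k

theorem convFormula_eq [ArrowGroupoid G X] (f : G → ℂ) (x : X) (ξ : SrcFiber G x → ℂ)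
    (g : SrcFiber G x) :
    convFormula f x ξ g = ∑' k : SrcFiber G x, f (mul g.1 (inv k.1)) * ξ k := by
  rw [← (fiberEquiv g).tsum_eq]
  refine tsum_congr fun h => ?_
  congr 2
  exact congrArg Subtype.val ((fiberEquiv g).symm_apply_apply h).symm

/-- Functions that are bounded and meet every source or range fibre in boundedly many points. -/
def FiberBounded [ArrowGroupoid G X] (f : G → ℂ) : Prop :=
  ∃ (N : ℕ) (C : ℝ), 0 ≤ C ∧ (∀ g, ‖f g‖ ≤ C) ∧
    (∀ x, {g | src g = x ∧ f g ≠ 0}.encard ≤ N) ∧ ∀ x, {g | rng g = x ∧ f g ≠ 0}.encard ≤ N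

theorem FiberBounded.zero [ArrowGroupoid G X] : FiberBounded (0 : G → ℂ) :=
  ⟨0, 0, le_rfl, by simp, by simp, by simp⟩

theorem FiberBounded.smul [ArrowGroupoid G X] {f : G → ℂ} (hf : FiberBounded f) (c : ℂ) :
    FiberBounded (c • f) := by
  obtain ⟨N, C, hC, h1, h2, h3⟩ := hf
  refine ⟨N, ‖c‖ * C, by positivity, fun g => ?_, fun x => ?_, fun x => ?_⟩
  · simp only [Pi.smul_apply, norm_smul]
    gcongr
    exact h1 g
  · refine (Set.encard_le_encard ?_).trans (h2 x)
    rintro g ⟨ha, hb⟩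
    exact ⟨ha, fun h => hb (by simp [h])⟩
  · refine (Set.encard_le_encard ?_).trans (h3 x)
    rintro g ⟨ha, hb⟩
    exact ⟨ha, fun h => hb (by simp [h])⟩

theorem FiberBounded.add [ArrowGroupoid G X] {f f' : G → ℂ} (hf : FiberBounded f)
    (hf' : FiberBounded f') : FiberBounded (f + f') := by
  obtain ⟨N, C, hC, h1, h2, h3⟩ := hf
  obtain ⟨N', C', hC', h1', h2', h3'⟩ := hf'
  have key : ∀ (p : G → Prop), {g | p g ∧ (f + f') g ≠ 0} ⊆
      {g | p g ∧ f g ≠ 0} ∪ {g | p g ∧ f' g ≠ 0} := by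
    rintro p g ⟨ha, hb⟩
    by_cases h : f g = 0
    · refine Or.inr ⟨ha, fun h' => hb (by simp [h, h'])⟩
    · exact Or.inl ⟨ha, h⟩
  refine ⟨N + N', C + C', by positivity, fun g => (norm_add_le _ _).trans
    (add_le_add (h1 g) (h1' g)), fun x => ?_, fun x => ?_⟩
  · refine (Set.encard_le_encard (key _)).trans ((Set.encard_union_le _ _).trans ?_)
    push_cast
    exact add_le_add (h2 x) (h2' x)
  · refine (Set.encard_le_encard (key _)).trans ((Set.encard_union_le _ _).trans ?_)
    push_cast
    exact add_le_add (h3 x) (h3' x)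

/-- Uniform boundedness of the operators `ξ ↦ convFormula f x ξ`. -/
theorem FiberBounded.exists_bound [ArrowGroupoid G X] {f : G → ℂ} (hf : FiberBounded f) :
    ∃ D : ℝ, 0 ≤ D ∧ ∀ (x : X) (ξ : L2 (SrcFiber G x)) (s : Finset (SrcFiber G x)),
      ∑ g ∈ s, ‖convFormula f x ξ g‖ ^ (2 : ℝ≥0∞).toReal ≤ (D * ‖ξ‖) ^ (2 : ℝ≥0∞).toReal := by
  obtain ⟨N, C, hC, h1, h2, h3⟩ := hf
  refine ⟨N * C, by positivity, fun x ξ s => ?_⟩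
  simp only [convFormula_eq]
  have hc : ∀ g k : SrcFiber G x, src g.1 = rng (inv k.1) := fun g k => by
    rw [rng_inv, g.2, k.2]
  refine kernel_sum_le (fun g k : SrcFiber G x => f (mul g.1 (inv k.1))) N C
    (fun _ _ => h1 _) (fun g => ?_) (fun k => ?_) ξ s
  · refine le_trans ?_ (h3 (rng g.1))
    refine Set.encard_le_encard_of_injOn (f := fun k => mul g.1 (inv k.1)) ?_ ?_
    · intro k hk
      exact ⟨rng_mul _ _ (hc g k), hk⟩
    · intro k _ k' _ hkk
      exact (fiberEquiv g).symm.injective (Subtype.ext hkk)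
  · refine le_trans ?_ (h2 (rng k.1))
    refine Set.encard_le_encard_of_injOn (f := fun g => mul g.1 (inv k.1)) ?_ ?_
    · intro g hg
      exact ⟨by rw [src_mul _ _ (hc g k), src_inv], hg⟩
    · intro g _ g' _ hgg
      have aux : ∀ g : SrcFiber G x, mul (mul g.1 (inv k.1)) k.1 = g.1 := fun g => by
        rw [assoc _ _ _ (hc g k) (src_inv _), inverse_mul, k.2]
        have := mul_unit g.1
        rwa [g.2] at this
      have : mul (mul g.1 (inv k.1)) k.1 = mul (mul g'.1 (inv k.1)) k.1 := by
        simp only at hgg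
        rw [hgg]
      rw [aux, aux] at this
      exact Subtype.ext this

/-- The functions on `G` obtained by extending by zero the elements of `C_c(V)`, where `V ⊆ G` is an
open Hausdorff subset. -/
def IsBasicCc [TopologicalSpace G] (f : G → ℂ) : Prop :=
  ∃ V : Set G, IsOpen V ∧ T2Space V ∧ ContinuousOn f V ∧
    ∃ K : Set G, IsCompact K ∧ K ⊆ V ∧ ∀ g ∉ K, f g = 0

/-- The space `C_c(G)` of functions on a not necessarily Hausdorff space: the linear span of the
spaces `C_c(V)` for all open Hausdorff subsets `V`. -/
def Cc (G : Type*) [TopologicalSpace G] : Submodule ℂ (G → ℂ) :=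
  Submodule.span ℂ {f | IsBasicCc f}

variable [TopologicalSpace G] [TopologicalSpace X]

theorem IsBasicCc.fiberBounded [EtaleGroupoid G X] {f : G → ℂ} (hf : IsBasicCc f) :
    FiberBounded f := by
  obtain ⟨V, -, -, hfV, K, hK, hKV, hf0⟩ := hf
  obtain ⟨C, hC⟩ := hK.exists_bound_of_continuousOn (hfV.mono hKV)
  have hloc : ∀ g : G, ∃ U : Set G, IsOpen U ∧ g ∈ U ∧ Set.InjOn src U ∧ Set.InjOn rng U := by
    intro g
    obtain ⟨e, he, hes⟩ := EtaleGroupoid.src_isLocalHomeomorph (G := G) g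
    obtain ⟨e', he', her⟩ := EtaleGroupoid.rng_isLocalHomeomorph (G := G) g
    refine ⟨e.source ∩ e'.source, e.open_source.inter e'.open_source, ⟨he, he'⟩, ?_, ?_⟩
    · rw [hes]
      exact e.injOn.mono Set.inter_subset_left
    · rw [her]
      exact e'.injOn.mono Set.inter_subset_right
  choose U hUo hUm hUs hUr using hloc
  obtain ⟨t, ht⟩ := hK.elim_finite_subcover U hUo fun g _ => Set.mem_iUnion.2 ⟨g, hUm g⟩
  have key : ∀ (p : G → X), (∀ g, Set.InjOn p (U g)) →
      ∀ x, {g | p g = x ∧ f g ≠ 0}.encard ≤ t.card := by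
    intro p hp x
    have hmem : ∀ g ∈ {g | p g = x ∧ f g ≠ 0}, ∃ a ∈ t, g ∈ U a := by
      rintro g ⟨-, hg⟩
      have hgK : g ∈ K := by
        by_contra h
        exact hg (hf0 g h)
      simpa using ht hgK
    choose! a ha ha' using hmem
    rw [← Set.encard_coe_eq_coe_finsetCard]
    refine Set.encard_le_encard_of_injOn (f := a) (fun g hg => ha g hg) ?_
    intro g hg g' hg' h
    refine hp (a g) (ha' g hg) ?_ (hg.1.trans hg'.1.symm)
    have h1 := ha' g' hg'
    rwa [← h] at h1
  refine ⟨t.card, max C 0, le_max_right _ _, fun g => ?_, key _ hUs, key _ hUr⟩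
  by_cases hg : g ∈ K
  · exact (hC g hg).trans (le_max_left _ _)
  · rw [hf0 g hg, norm_zero]
    exact le_max_right _ _

theorem fiberBounded_of_mem_Cc [EtaleGroupoid G X] {f : G → ℂ} (hf : f ∈ Cc G) :
    FiberBounded f := by
  induction hf using Submodule.span_induction with
  | mem f hf => exact IsBasicCc.fiberBounded hf
  | zero => exact FiberBounded.zero
  | add f g _ _ h1 h2 => exact h1.add h2
  | smul c f _ h => exact h.smul c

theorem memℓp_convFormula [EtaleGroupoid G X] (f : Cc G) (x : X) (ξ : L2 (SrcFiber G x)) :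
    Memℓp (convFormula (f : G → ℂ) x ξ) 2 := by
  obtain ⟨D, -, hD⟩ := (fiberBounded_of_mem_Cc f.2).exists_bound
  exact memℓp_gen' (hD x ξ)

theorem summable_convFormula [EtaleGroupoid G X] (f : Cc G) (x : X) (ξ : L2 (SrcFiber G x))
    (g : SrcFiber G x) : Summable fun h : RngFiber G (rng g.1) =>
      (f : G → ℂ) h.1 * ξ ⟨mul (inv h.1) g.1, src_inv_mul g h⟩ := by
  obtain ⟨N, C, -, -, -, h3⟩ := fiberBounded_of_mem_Cc f.2
  have hfin := Set.finite_of_encard_le_coe (h3 (rng g.1))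
  refine summable_of_hasFiniteSupport (Set.Finite.subset
    (hfin.preimage (f := fun h : RngFiber G (rng g.1) => h.1) Subtype.val_injective.injOn) ?_)
  intro h hh
  exact ⟨h.2, fun h0 => hh (by simp [h0])⟩

/-- The representation `ρ_x : C_c(G) → B(ℓ²(G_x))`,
`(ρ_x(f)ξ)(g) = ∑_{h ∈ G^{r(g)}} f(h) ξ(h⁻¹g)`. -/
noncomputable def rho [EtaleGroupoid G X] (x : X) (f : Cc G) :
    L2 (SrcFiber G x) →L[ℂ] L2 (SrcFiber G x) :=
  LinearMap.mkContinuousOfExistsBound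
    { toFun := fun ξ => ⟨convFormula (f : G → ℂ) x ξ, memℓp_convFormula f x ξ⟩
      map_add' := fun ξ η => by
        ext g
        simp only [convFormula, lp.coeFn_add, Pi.add_apply, mul_add]
        exact (summable_convFormula f x ξ g).tsum_add (summable_convFormula f x η g)
      map_smul' := fun c ξ => by
        ext g
        simp only [convFormula, lp.coeFn_smul, Pi.smul_apply, smul_eq_mul, RingHom.id_apply,
          ← tsum_mul_left]
        exact tsum_congr fun h => by ring }
    (by
      obtain ⟨D, hD0, hD⟩ := (fiberBounded_of_mem_Cc f.2).exists_bound
      exact ⟨D, fun ξ => lp.norm_le_of_forall_sum_le (by simp) (by positivity) (hD x ξ)⟩)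

theorem rho_apply [EtaleGroupoid G X] (x : X) (f : Cc G) (ξ : L2 (SrcFiber G x))
    (g : SrcFiber G x) : rho x f ξ g = ∑' h : RngFiber G (rng g.1),
      (f : G → ℂ) h.1 * ξ ⟨mul (inv h.1) g.1, src_inv_mul g h⟩ := rfl

theorem memℓp_rho [EtaleGroupoid G X] (f : Cc G) :
    Memℓp (fun x : X => rho (G := G) x f) ∞ := by
  obtain ⟨D, hD0, hD⟩ := (fiberBounded_of_mem_Cc f.2).exists_bound
  refine memℓp_infty ⟨D, ?_⟩
  rintro _ ⟨x, rfl⟩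
  exact ContinuousLinearMap.opNorm_le_bound _ hD0 fun ξ =>
    lp.norm_le_of_forall_sum_le (by simp) (by positivity) (hD x ξ)

end General

section Reduced

open ArrowGroupoid

/-- The `ℓ^∞`-product of the algebras `B(ℓ²(ι_x))`, `x ∈ X`, with the supremum norm. -/
def OpProduct {X : Type*} (ι : X → Type*) : Type _ :=
  lp (fun x : X => L2 (ι x) →L[ℂ] L2 (ι x)) ∞

namespace OpProduct

variable {X : Type*} (ι : X → Type*)

noncomputable instance : NonUnitalNormedRing (OpProduct ι) :=
  inferInstanceAs (NonUnitalNormedRing (lp (fun x : X => L2 (ι x) →L[ℂ] L2 (ι x)) ∞))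

noncomputable instance : StarRing (OpProduct ι) :=
  inferInstanceAs (StarRing (lp (fun x : X => L2 (ι x) →L[ℂ] L2 (ι x)) ∞))

instance : CStarRing (OpProduct ι) :=
  inferInstanceAs (CStarRing (lp (fun x : X => L2 (ι x) →L[ℂ] L2 (ι x)) ∞))

noncomputable instance : NormedSpace ℂ (OpProduct ι) :=
  inferInstanceAs (NormedSpace ℂ (lp (fun x : X => L2 (ι x) →L[ℂ] L2 (ι x)) ∞))

instance : StarModule ℂ (OpProduct ι) :=
  inferInstanceAs (StarModule ℂ (lp (fun x : X => L2 (ι x) →L[ℂ] L2 (ι x)) ∞))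

instance : IsScalarTower ℂ (OpProduct ι) (OpProduct ι) :=
  inferInstanceAs (IsScalarTower ℂ (lp (fun x : X => L2 (ι x) →L[ℂ] L2 (ι x)) ∞)
    (lp (fun x : X => L2 (ι x) →L[ℂ] L2 (ι x)) ∞))

instance : SMulCommClass ℂ (OpProduct ι) (OpProduct ι) :=
  inferInstanceAs (SMulCommClass ℂ (lp (fun x : X => L2 (ι x) →L[ℂ] L2 (ι x)) ∞)
    (lp (fun x : X => L2 (ι x) →L[ℂ] L2 (ι x)) ∞))

instance : CompleteSpace (OpProduct ι) :=
  inferInstanceAs (CompleteSpace (lp (fun x : X => L2 (ι x) →L[ℂ] L2 (ι x)) ∞))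

variable {ι}

/-- The projection of the product onto its `x`-th factor. -/
noncomputable def eval (x : X) : OpProduct ι →⋆ₙₐ[ℂ] (L2 (ι x) →L[ℂ] L2 (ι x)) where
  toFun a := (show lp (fun x : X => L2 (ι x) →L[ℂ] L2 (ι x)) ∞ from a) x
  map_smul' _ _ := rfl
  map_zero' := rfl
  map_add' _ _ := rfl
  map_mul' _ _ := rfl
  map_star' _ := rfl

end OpProduct

variable (G : Type*) {X : Type*} [TopologicalSpace G] [TopologicalSpace X] [EtaleGroupoid G X]

variable {G} in
/-- The family `(ρ_x(f))_x`. Its norm is `sup_x ‖ρ_x(f)‖`, the reduced norm of `f`. -/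
noncomputable def regularFamily (f : Cc G) : OpProduct (SrcFiber G : X → Type _) :=
  (⟨fun x => rho x f, memℓp_rho f⟩ :
    lp (fun x : X => L2 (SrcFiber G x) →L[ℂ] L2 (SrcFiber G x)) ∞)

/-- The reduced C*-algebra `C*_r(G)`: the completion of (the image under `f ↦ (ρ_x(f))_x` of)
`C_c(G)` with respect to the norm `sup_x ‖ρ_x(f)‖`, realized as the closure of this image in the
product of the algebras `B(ℓ²(G_x))`. The image is already a `*`-subalgebra, since `C_c(G)` is closed
under convolution and involution, so `adjoin` adds no elements. -/
noncomputable def reducedGroupoidAlgebra :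
    NonUnitalStarSubalgebra ℂ (OpProduct (SrcFiber G : X → Type _)) :=
  (NonUnitalStarAlgebra.adjoin ℂ (Set.range (regularFamily (G := G)))).topologicalClosure

/-- The class of `f ∈ C_c(G)` in `C*_r(G)`. -/
noncomputable def toReduced (f : Cc G) : reducedGroupoidAlgebra G :=
  ⟨regularFamily f, NonUnitalStarSubalgebra.le_topologicalClosure _
    (NonUnitalStarAlgebra.subset_adjoin _ _ ⟨f, rfl⟩)⟩

/-- The extension of the representation `ρ_x` from `C_c(G)` to `C*_r(G)`. -/
noncomputable def rhoReduced (x : X) :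
    reducedGroupoidAlgebra G →⋆ₙₐ[ℂ] (L2 (SrcFiber G x) →L[ℂ] L2 (SrcFiber G x)) :=
  (OpProduct.eval x).comp (NonUnitalStarSubalgebraClass.subtype (reducedGroupoidAlgebra G))

theorem rhoReduced_toReduced (x : X) (f : Cc G) : rhoReduced G x (toReduced G f) = rho x f := rfl

theorem norm_toReduced (f : Cc G) : ‖toReduced G f‖ = ⨆ x : X, ‖rho x f‖ :=
  lp.norm_eq_ciSup (⟨fun x => rho x f, memℓp_rho f⟩ :
    lp (fun x : X => L2 (SrcFiber G x) →L[ℂ] L2 (SrcFiber G x)) ∞)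

end Reduced

/-! ### The left inverse hull, constructible ideals and semi-characters -/

section Hull

open Classical in
/-- The identity map `p_X` of a subset `X`, as a partial bijection. -/
noncomputable def idOn {T : Type*} (X : Set T) : T ≃. T := PEquiv.ofSet X

theorem idOn_eq_some_iff {T : Type*} {X : Set T} {s t : T} : idOn X s = some t ↔ t = s ∧ t ∈ X :=
  PEquiv.ofSet_eq_some_iff

variable {S : Type*} [LeftCancelMonoid S]

open Classical in
/-- The left translation `t ↦ st`, as a partial bijection of `S` with domain `S` and image `sS`. -/
noncomputable def leftTranslation (s : S) : S ≃. S where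
  toFun t := some (s * t)
  invFun r := if h : ∃ t, s * t = r then some h.choose else none
  inv t r := by
    constructor
    · intro h
      split_ifs at h with h'
      have : h'.choose = t := by simpa using h
      rw [← this]
      exact congrArg some h'.choose_spec
    · intro h
      have h1 : s * t = r := by simpa using h
      have h2 : ∃ t, s * t = r := ⟨t, h1⟩
      rw [dif_pos h2]
      have : h2.choose = t := mul_left_cancel (h2.choose_spec.trans h1.symm)
      simp [this]

/-- Membership in the left inverse hull: the partial bijections of `S` obtained from the left
translations by composition and inversion. -/
inductive InLeftHull : (S ≃. S) → Prop
  | translation (s : S) : InLeftHull (leftTranslation s)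
  | trans {g h : S ≃. S} : InLeftHull g → InLeftHull h → InLeftHull (g.trans h)
  | symm {g : S ≃. S} : InLeftHull g → InLeftHull g.symm

variable (S) in
/-- The left inverse hull `I_ℓ(S)`. For `g` in it, `g.1 s = some t` means that `s` is in the domain
of `g` and `g` maps `s` to `t`. -/
def LeftHull : Type _ := {g : S ≃. S // InLeftHull g}

theorem inLeftHull_refl : InLeftHull (PEquiv.refl S) := by
  have : leftTranslation (1 : S) = PEquiv.refl S := PEquiv.ext fun t => by
    change some (1 * t) = some t
    rw [one_mul]
  rw [← this]
  exact InLeftHull.translation 1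

namespace LeftHull

/-- The left translation by `s` as an element of `I_ℓ(S)`. -/
noncomputable def ofElem (s : S) : LeftHull S := ⟨leftTranslation s, InLeftHull.translation s⟩

/-- The identity map `p_S`. -/
def one : LeftHull S := ⟨PEquiv.refl S, inLeftHull_refl⟩

/-- The product `gh` in `I_ℓ(S)`: first apply `h`, then `g`. -/
def comp (g h : LeftHull S) : LeftHull S := ⟨h.1.trans g.1, h.2.trans g.2⟩

/-- The inverse in `I_ℓ(S)`. -/
def inv (g : LeftHull S) : LeftHull S := ⟨g.1.symm, g.2.symm⟩

end LeftHull

/-- A subset `X` of `S` is a constructible ideal if the identity map `p_X` of `X` belongs to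
`I_ℓ(S)`, that is, if `X` is the domain of an idempotent of `I_ℓ(S)`. -/
def IsConstructible (X : Set S) : Prop := InLeftHull (idOn X)

variable (S) in
/-- The collection `J(S)` of constructible ideals, which is identified with the semigroup `E(S)` of
idempotents of `I_ℓ(S)` by `X ↦ p_X`; the product of `E(S)` becomes the intersection. -/
def Constructible : Type _ := {X : Set S // IsConstructible X}

/-- The preimage of a set under a partial bijection. -/
def preimageSet (g : S ≃. S) (X : Set S) : Set S := {s | ∃ t, g s = some t ∧ t ∈ X}

theorem isConstructible_preimage {g : S ≃. S} (hg : InLeftHull g) {X : Set S}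
    (hX : IsConstructible X) : IsConstructible (preimageSet g X) := by
  have : idOn (preimageSet g X) = (g.trans (idOn X)).trans g.symm := by
    refine PEquiv.ext fun a => Option.ext fun b => ?_
    simp only [PEquiv.trans_eq_some, idOn_eq_some_iff, PEquiv.eq_some_iff]
    constructor
    · rintro ⟨rfl, t, ht, htX⟩
      exact ⟨t, ⟨t, ht, rfl, htX⟩, ht⟩
    · rintro ⟨t, ⟨u, hu, rfl, htX⟩, hb⟩
      exact ⟨g.inj hb hu, t, hb, htX⟩
  unfold IsConstructible
  rw [this]
  exact (hg.trans hX).trans hg.symm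

theorem isConstructible_univ : IsConstructible (Set.univ : Set S) := by
  have : idOn (Set.univ : Set S) = PEquiv.refl S :=
    PEquiv.ext fun a => Option.ext fun b => by
      rw [idOn_eq_some_iff, PEquiv.refl_apply, Option.some.injEq]
      simp [eq_comm]
  unfold IsConstructible
  rw [this]
  exact inLeftHull_refl

theorem isConstructible_inter {X Y : Set S} (hX : IsConstructible X) (hY : IsConstructible Y) :
    IsConstructible (X ∩ Y) := by
  have h : preimageSet (idOn X) Y = X ∩ Y := by
    ext s
    constructor
    · rintro ⟨t, h1, h2⟩
      obtain ⟨rfl, h3⟩ := idOn_eq_some_iff.1 h1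
      exact ⟨h3, h2⟩
    · rintro ⟨h1, h2⟩
      exact ⟨s, idOn_eq_some_iff.2 ⟨rfl, h1⟩, h2⟩
  rw [← h]
  exact isConstructible_preimage hX hY

namespace Constructible

/-- The intersection of two constructible ideals; `p_{X ∩ Y} = p_X p_Y`. -/
def inter (X Y : Constructible S) : Constructible S := ⟨X.1 ∩ Y.1, isConstructible_inter X.2 Y.2⟩

variable (S) in
/-- The ideal `S`. -/
def top : Constructible S := ⟨Set.univ, isConstructible_univ⟩

/-- The preimage `g⁻¹(X)`; it satisfies `p_{g⁻¹(X)} = g⁻¹ p_X g`. -/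
def preimage (g : LeftHull S) (X : Constructible S) : Constructible S :=
  ⟨preimageSet g.1 X.1, isConstructible_preimage g.2 X.2⟩

/-- The domain of `g ∈ I_ℓ(S)`; it satisfies `p_{dom g} = g⁻¹g`. -/
def dom (g : LeftHull S) : Constructible S := preimage g (top S)

theorem mem_preimage {g : LeftHull S} {X : Constructible S} {s : S} :
    s ∈ (preimage g X).1 ↔ ∃ t, g.1 s = some t ∧ t ∈ X.1 := Iff.rfl

theorem mem_dom {g : LeftHull S} {s : S} : s ∈ (dom g).1 ↔ ∃ t, g.1 s = some t := by
  exact ⟨fun ⟨t, h, _⟩ => ⟨t, h⟩, fun ⟨t, h⟩ => ⟨t, h, trivial⟩⟩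

theorem inter_comm (X Y : Constructible S) : inter X Y = inter Y X :=
  Subtype.ext (Set.inter_comm _ _)

end Constructible

open Constructible

variable (S) in
/-- The space of semi-characters of `E(S) ≅ J(S)`: multiplicative maps to `{0, 1}` that are not
identically zero, with the topology of pointwise convergence. -/
def Semicharacter : Type _ :=
  {χ : Constructible S → Bool // (∃ X, χ X = true) ∧ ∀ X Y, χ (inter X Y) = (χ X && χ Y)}

instance : TopologicalSpace (Semicharacter S) :=
  inferInstanceAs (TopologicalSpace {χ : Constructible S → Bool //
    (∃ X, χ X = true) ∧ ∀ X Y, χ (inter X Y) = (χ X && χ Y)})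

open Classical in
/-- The semi-character `χ_s`, `χ_s(p_X) = 1_X(s)`. -/
noncomputable def charAt (s : S) : Semicharacter S :=
  ⟨fun X => decide (s ∈ X.1), ⟨top S, by simp [top]⟩, fun X Y => by simp [inter]⟩

variable (S) in
/-- The space `Ω(S)`, the closure of `{χ_s | s ∈ S}` in the space of semi-characters. -/
def Omega : Type _ := {χ : Semicharacter S // χ ∈ closure (Set.range (charAt (S := S)))}

noncomputable instance : TopologicalSpace (Omega S) :=
  inferInstanceAs (TopologicalSpace {χ : Semicharacter S //
    χ ∈ closure (Set.range (charAt (S := S)))})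

/-- The point `χ_s` of `Ω(S)`. -/
noncomputable def Omega.point (s : S) : Omega S := ⟨charAt s, subset_closure ⟨s, rfl⟩⟩

/-- The value `χ(p_X)`. -/
def Omega.val (χ : Omega S) (X : Constructible S) : Bool := χ.1.1 X

/-! ### The extension of semi-characters and C*-regularity -/

/-- The set `X \ (X_1 ∪ ⋯ ∪ X_m)` for `F = {X_1, …, X_m}`. -/
def diffSet (X : Constructible S) (F : Finset (Constructible S)) : Set S :=
  X.1 \ ⋃ Y ∈ F, Y.1

variable (S) in
/-- The collection `J̄(S)` of sets `X \ (X_1 ∪ ⋯ ∪ X_m)` with `X, X_1, …, X_m ∈ J(S)` (including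
`m = 0`). -/
def barConstructible : Set (Set S) := {A | ∃ X F, A = diffSet X F}

/-- The relation `χ(p_A) = 1` for the extension of `χ ∈ Ω(S)` to `J̄(S)`: for
`A = X \ (X_1 ∪ ⋯ ∪ X_m)` it means that `χ(p_X) = 1` and `χ(p_{X_i}) = 0` for all `i`. -/
def Omega.BarOne (χ : Omega S) (A : Set S) : Prop :=
  ∃ X F, A = diffSet X F ∧ χ.val X = true ∧ ∀ Y ∈ F, χ.val Y = false

variable (S) in
/-- C*-regularity of `S`: whenever a nonempty set `A ∈ J̄(S)` is covered by the sets of fixed points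
of finitely many `h_k ∈ I_ℓ(S)`, it is covered by finitely many sets `Y_j ∈ J̄(S)` such that each
`Y_j` consists of fixed points of a single `h_{k_j}`. -/
def IsCStarRegular : Prop :=
  ∀ (n : ℕ) (h : Fin n → LeftHull S) (A : Set S), A ∈ barConstructible S → A.Nonempty →
    (A ⊆ ⋃ k, {s | (h k).1 s = some s}) →
    ∃ (l : ℕ) (Y : Fin l → Set S) (k : Fin l → Fin n),
      (∀ j, Y j ∈ barConstructible S) ∧ (A ⊆ ⋃ j, Y j) ∧
        ∀ j, ∀ s ∈ Y j, (h (k j)).1 s = some s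

/-! ### The groupoid `𝒢(S)` -/

/-- The pairs `(g, χ)` with `g ∈ I_ℓ(S)`, `χ ∈ Ω(S)` and `χ(g⁻¹g) = 1`. -/
@[ext] structure GermPair (S : Type*) [LeftCancelMonoid S] where
  elt : LeftHull S
  chi : Omega S
  mem : chi.val (dom elt) = true

/-- The relation `(g, χ) ∼ (h, χ)` iff `g|_A = h|_A` for some `A ∈ J̄(S)` with `χ(p_A) = 1`. It is
implied by the relation `gp_X = hp_X` for some `X ∈ J(S)` with `χ(p_X) = 1`, which defines the
reduction of the Paterson groupoid to `Ω(S)`. -/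
def GermPair.Rel (p q : GermPair S) : Prop :=
  p.chi = q.chi ∧ ∃ A, p.chi.BarOne A ∧ ∀ s ∈ A, p.elt.1 s = q.elt.1 s

theorem Omega.ext {χ ψ : Omega S} (h : ∀ X, χ.val X = ψ.val X) : χ = ψ :=
  Subtype.ext (Subtype.ext (funext h))

theorem Omega.continuous_val (X : Constructible S) : Continuous fun χ : Omega S => χ.val X :=
  (continuous_apply X).comp (continuous_subtype_val.comp continuous_subtype_val)

theorem Omega.val_inter (χ : Omega S) (X Y : Constructible S) :
    χ.val (inter X Y) = (χ.val X && χ.val Y) := χ.1.2.2 X Y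

theorem Omega.val_top (χ : Omega S) : χ.val (top S) = true := by
  obtain ⟨X, hX⟩ := χ.1.2.1
  have h1 : inter X (top S) = X := Subtype.ext (Set.inter_univ _)
  have h2 := χ.val_inter X (top S)
  rw [h1] at h2
  have hX' : χ.val X = true := hX
  rw [hX'] at h2
  simpa using h2.symm

theorem Omega.val_point (s : S) (X : Constructible S) :
    (Omega.point s).val X = true ↔ s ∈ X.1 := by
  simp [Omega.point, Omega.val, charAt]

/-- The filter on `S` of the sets containing all `s` with `χ_s` close to `χ`. -/
noncomputable def Omega.near (χ : Omega S) : Filter S := Filter.comap charAt (𝓝 χ.1)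

instance (χ : Omega S) : χ.near.NeBot := by
  rw [Omega.near, Filter.comap_neBot_iff_frequently]
  exact mem_closure_iff_frequently.1 χ.2

theorem Omega.near_iff (χ : Omega S) (X : Constructible S) :
    ∀ᶠ s in χ.near, (s ∈ X.1 ↔ χ.val X = true) := by
  have h1 : Continuous fun η : Semicharacter S => η.1 X :=
    (continuous_apply X).comp continuous_subtype_val
  have h2 : ∀ᶠ η : Semicharacter S in 𝓝 χ.1, η.1 X = χ.1.1 X :=
    h1.continuousAt.eventually_mem (IsOpen.mem_nhds (isOpen_discrete {χ.1.1 X}) rfl)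
  filter_upwards [Filter.preimage_mem_comap h2] with s hs
  have : (charAt s).1 X = χ.val X := hs
  rw [← this]
  simp [charAt]

theorem Omega.tendsto_of_forall {l : Filter S} {m : S → S} {η : Semicharacter S}
    (h : ∀ X, ∀ᶠ s in l, (m s ∈ X.1 ↔ η.1 X = true)) :
    Filter.Tendsto (fun s => charAt (m s)) l (𝓝 η) := by
  refine tendsto_subtype_rng.2 (tendsto_pi_nhds.2 fun X => ?_)
  refine tendsto_nhds_of_eventually_eq ?_
  filter_upwards [h X] with s hs
  have : (charAt (m s)).1 X = true ↔ η.1 X = true := by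
    rw [← hs]
    simp [charAt]
  exact Bool.eq_iff_iff.2 this

theorem Omega.barOne_mem_near {χ : Omega S} {A : Set S} (h : χ.BarOne A) :
    ∀ᶠ s in χ.near, s ∈ A := by
  obtain ⟨X, F, rfl, hX, hF⟩ := h
  have h2 : ∀ᶠ s in χ.near, ∀ Y ∈ F, s ∉ Y.1 := by
    rw [Filter.eventually_all_finset]
    intro Y hY
    filter_upwards [χ.near_iff Y] with s hs hsY
    have := hs.1 hsY
    rw [hF Y hY] at this
    exact absurd this (by simp)
  filter_upwards [χ.near_iff X, h2] with s hs1 hs2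
  refine ⟨hs1.2 hX, ?_⟩
  simpa using hs2

theorem Omega.exists_barOne {χ : Omega S} {p : S → Prop} (h : ∀ᶠ s in χ.near, p s) :
    ∃ A, χ.BarOne A ∧ ∀ s ∈ A, p s := by
  classical
  obtain ⟨W, hW, hWp⟩ := Filter.mem_comap.1 h
  obtain ⟨V, hVW, hVo, hχV⟩ := mem_nhds_iff.1 hW
  obtain ⟨V', hV'o, rfl⟩ := isOpen_induced_iff.1 hVo
  obtain ⟨I, u, hu, hIu⟩ := isOpen_pi_iff.1 hV'o χ.1.1 hχV
  have key : ∀ I : Finset (Constructible S), ∃ X, χ.val X = true ∧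
      ∀ Y ∈ I, χ.val Y = true → X.1 ⊆ Y.1 := by
    intro I
    induction I using Finset.induction_on with
    | empty => exact ⟨top S, χ.val_top, by simp⟩
    | insert Y I _ ih =>
      obtain ⟨X, hX, hXI⟩ := ih
      by_cases hY : χ.val Y = true
      · refine ⟨inter X Y, by rw [χ.val_inter, hX, hY]; rfl, fun Z hZ hZ1 => ?_⟩
        rcases Finset.mem_insert.1 hZ with rfl | hZ
        · exact Set.inter_subset_right
        · exact Set.inter_subset_left.trans (hXI Z hZ hZ1)
      · refine ⟨X, hX, fun Z hZ hZ1 => ?_⟩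
        rcases Finset.mem_insert.1 hZ with rfl | hZ
        · exact absurd hZ1 hY
        · exact hXI Z hZ hZ1
  obtain ⟨X, hX, hXI⟩ := key I
  refine ⟨_, ⟨X, I.filter fun Y => χ.val Y = false, rfl, hX, fun Y hY => (Finset.mem_filter.1 hY).2⟩,
    fun s hs => hWp (hVW ?_)⟩
  refine hIu fun Y hY => ?_
  have : (charAt s).1 Y = χ.1.1 Y := by
    cases hYv : χ.val Y with
    | true =>
      have h1 : s ∈ Y.1 := hXI Y hY hYv hs.1
      have h2 : χ.1.1 Y = true := hYv
      rw [h2]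
      simp [charAt, h1]
    | false =>
      have h1 : s ∉ Y.1 := fun h => hs.2 (by
        simp only [Set.mem_iUnion]
        exact ⟨Y, Finset.mem_filter.2 ⟨hY, hYv⟩, h⟩)
      have h2 : χ.1.1 Y = false := hYv
      rw [h2]
      simp [charAt, h1]
  rw [this]
  exact (hu Y hY).2

theorem GermPair.rel_iff {p q : GermPair S} :
    p.Rel q ↔ p.chi = q.chi ∧ ∀ᶠ s in p.chi.near, p.elt.1 s = q.elt.1 s := by
  refine and_congr_right fun _ => ⟨?_, fun h => Omega.exists_barOne h⟩
  rintro ⟨A, hA, h⟩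
  filter_upwards [Omega.barOne_mem_near hA] with s hs using h s hs

instance germSetoid : Setoid (GermPair S) where
  r := GermPair.Rel
  iseqv := by
    refine ⟨fun p => ?_, fun {p q} h => ?_, fun {p q r} h1 h2 => ?_⟩
    · exact GermPair.rel_iff.2 ⟨rfl, Filter.Eventually.of_forall fun _ => rfl⟩
    · rw [GermPair.rel_iff] at h ⊢
      refine ⟨h.1.symm, ?_⟩
      rw [← h.1]
      filter_upwards [h.2] with s hs using hs.symm
    · rw [GermPair.rel_iff] at h1 h2 ⊢
      refine ⟨h1.1.trans h2.1, ?_⟩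
      have h3 := h2.2
      rw [← h1.1] at h3
      filter_upwards [h1.2, h3] with s hs hs' using hs.trans hs'

/-- If `χ(dom g) = 1`, then `g s` is defined for `χ_s` close to `χ`. -/
theorem Omega.near_dom {χ : Omega S} {g : LeftHull S} (h : χ.val (dom g) = true) :
    ∀ᶠ s in χ.near, ∃ t, g.1 s = some t := by
  filter_upwards [χ.near_iff (dom g)] with s hs
  exact mem_dom.1 (hs.2 h)

/-- The semi-character `χ(g⁻¹ · g)`, that is, `p_X ↦ χ(g⁻¹ p_X g) = χ(p_{g⁻¹(X)})`. -/
def actSemi (g : LeftHull S) (χ : Omega S) (h : χ.val (dom g) = true) : Semicharacter S :=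
  ⟨fun X => χ.val (preimage g X), ⟨top S, h⟩, fun X Y => by
    rw [← χ.val_inter]
    refine congrArg χ.val (Subtype.ext (Set.ext fun s => ?_))
    simp only [inter, preimage, preimageSet, Set.mem_inter_iff, Set.mem_ofPred_eq]
    constructor
    · rintro ⟨t, h1, h2, h3⟩
      exact ⟨⟨t, h1, h2⟩, t, h1, h3⟩
    · rintro ⟨⟨t, h1, h2⟩, u, h3, h4⟩
      rw [h1] at h3
      obtain rfl := Option.some.inj h3
      exact ⟨t, h1, h2, h4⟩⟩

theorem tendsto_actSemi (g : LeftHull S) (χ : Omega S) (h : χ.val (dom g) = true) :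
    Filter.Tendsto (fun s => charAt ((g.1 s).getD 1)) χ.near (𝓝 (actSemi g χ h)) := by
  refine Omega.tendsto_of_forall fun X => ?_
  filter_upwards [χ.near_iff (preimage g X), Omega.near_dom h] with s h1 ⟨t, h2⟩
  change _ ↔ χ.val (preimage g X) = true
  rw [← h1, mem_preimage, h2]
  simp

/-- The action `χ ↦ χ(g⁻¹ · g)` of `g ∈ I_ℓ(S)` on the set of `χ ∈ Ω(S)` with `χ(g⁻¹g) = 1`. -/
def act (g : LeftHull S) (χ : Omega S) (h : χ.val (dom g) = true) : Omega S :=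
  ⟨actSemi g χ h, mem_closure_of_tendsto (tendsto_actSemi g χ h)
    (Filter.Eventually.of_forall fun _ => ⟨_, rfl⟩)⟩

theorem act_val (g : LeftHull S) (χ : Omega S) (h : χ.val (dom g) = true) (X : Constructible S) :
    (act g χ h).val X = χ.val (preimage g X) := rfl

theorem near_act {g : LeftHull S} {χ : Omega S} (h : χ.val (dom g) = true) {p : S → Prop}
    (hp : ∀ᶠ t in (act g χ h).near, p t) : ∀ᶠ s in χ.near, ∃ t, g.1 s = some t ∧ p t := by
  have h1 : Filter.Tendsto (fun s => (g.1 s).getD 1) χ.near (act g χ h).near :=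
    Filter.tendsto_comap_iff.2 (tendsto_actSemi g χ h)
  filter_upwards [h1.eventually hp, Omega.near_dom h] with s h2 ⟨t, h3⟩
  rw [h3] at h2
  exact ⟨t, h3, h2⟩

/-- Two points of `Ω(S)` agree at `X`, `Y` if `X` and `Y` contain the same points near `χ`. -/
theorem Omega.val_congr {χ : Omega S} {X Y : Constructible S}
    (h : ∀ᶠ s in χ.near, (s ∈ X.1 ↔ s ∈ Y.1)) : χ.val X = χ.val Y := by
  obtain ⟨s, h1, h2, h3⟩ := (h.and ((χ.near_iff X).and (χ.near_iff Y))).exists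
  exact Bool.eq_iff_iff.2 (by rw [← h2, ← h3, h1])

theorem act_congr {g h : LeftHull S} {χ : Omega S} (hg : χ.val (dom g) = true)
    (hh : χ.val (dom h) = true) (e : ∀ᶠ s in χ.near, g.1 s = h.1 s) :
    act g χ hg = act h χ hh := by
  refine Omega.ext fun X => ?_
  rw [act_val, act_val]
  refine Omega.val_congr ?_
  filter_upwards [e] with s hs
  rw [mem_preimage, mem_preimage, hs]

theorem act_inv_mem {g : LeftHull S} {χ : Omega S} (h : χ.val (dom g) = true) :
    (act g χ h).val (dom g.inv) = true := by
  rw [act_val, ← h]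
  refine Omega.val_congr (Filter.Eventually.of_forall fun s => ?_)
  rw [mem_preimage, mem_dom]
  constructor
  · rintro ⟨t, h1, -⟩
    exact ⟨t, h1⟩
  · rintro ⟨t, h1⟩
    exact ⟨t, h1, mem_dom.2 ⟨s, (PEquiv.eq_some_iff g.1).2 h1⟩⟩

theorem act_inv_act {g : LeftHull S} {χ : Omega S} (h : χ.val (dom g) = true) :
    act g.inv (act g χ h) (act_inv_mem h) = χ := by
  refine Omega.ext fun X => ?_
  rw [act_val, act_val]
  refine Omega.val_congr ?_
  filter_upwards [Omega.near_dom h] with s ⟨t, ht⟩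
  constructor
  · rintro ⟨t', h1, u, h2, h3⟩
    have h4 : g.1 u = some t' := (PEquiv.eq_some_iff g.1).1 h2
    rwa [g.1.inj h1 h4]
  · intro h1
    exact ⟨t, ht, s, (PEquiv.eq_some_iff g.1).2 ht, h1⟩

theorem near_act_inv {g : LeftHull S} {χ : Omega S} (h : χ.val (dom g) = true) {p : S → Prop}
    (hp : ∀ᶠ s in χ.near, p s) :
    ∀ᶠ t in (act g χ h).near, ∃ s, g.1 s = some t ∧ p s := by
  have h1 : ∀ᶠ s in (act g.inv (act g χ h) (act_inv_mem h)).near, p s := by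
    rwa [act_inv_act h]
  filter_upwards [near_act _ h1] with t ⟨s, h2, h3⟩
  exact ⟨s, (PEquiv.eq_some_iff g.1).1 h2, h3⟩

theorem comp_apply_eq_some {g h : LeftHull S} {s t : S} :
    (g.comp h).1 s = some t ↔ ∃ u, h.1 s = some u ∧ g.1 u = some t :=
  PEquiv.trans_eq_some _ _ _ _

theorem comp_mem {g h : LeftHull S} {χ : Omega S} (hh : χ.val (dom h) = true)
    (hg : (act h χ hh).val (dom g) = true) : χ.val (dom (g.comp h)) = true := by
  rw [← hg, act_val]
  refine Omega.val_congr (Filter.Eventually.of_forall fun s => ?_)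
  simp only [mem_dom, mem_preimage, comp_apply_eq_some]
  constructor
  · rintro ⟨t, u, h1, h2⟩
    exact ⟨u, h1, t, h2⟩
  · rintro ⟨u, h1, t, h2⟩
    exact ⟨t, u, h1, h2⟩

theorem act_comp {g h : LeftHull S} {χ : Omega S} (hh : χ.val (dom h) = true)
    (hg : (act h χ hh).val (dom g) = true) :
    act (g.comp h) χ (comp_mem hh hg) = act g (act h χ hh) hg := by
  refine Omega.ext fun X => ?_
  simp only [act_val]
  refine Omega.val_congr (Filter.Eventually.of_forall fun s => ?_)
  simp only [mem_preimage, comp_apply_eq_some]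
  constructor
  · rintro ⟨t, ⟨u, h1, h2⟩, h3⟩
    exact ⟨u, h1, t, h2, h3⟩
  · rintro ⟨u, h1, t, h2, h3⟩
    exact ⟨t, ⟨u, h1, h2⟩, h3⟩

theorem one_mem (χ : Omega S) : χ.val (dom LeftHull.one) = true := by
  rw [← χ.val_top]
  refine Omega.val_congr (Filter.Eventually.of_forall fun s => ?_)
  rw [mem_dom]
  exact ⟨fun _ => trivial, fun _ => ⟨s, rfl⟩⟩

theorem act_one (χ : Omega S) : act LeftHull.one χ (one_mem χ) = χ := by
  refine Omega.ext fun X => ?_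
  rw [act_val]
  refine Omega.val_congr (Filter.Eventually.of_forall fun s => ?_)
  rw [mem_preimage]
  constructor
  · rintro ⟨t, h1, h2⟩
    obtain rfl : s = t := Option.some.inj h1
    exact h2
  · exact fun h => ⟨s, rfl, h⟩

/-- The range `χ(g⁻¹ · g)` of `(g, χ)`. -/
def GermPair.range (p : GermPair S) : Omega S := act p.elt p.chi p.mem

theorem GermPair.range_congr {p q : GermPair S} (h : p.Rel q) : p.range = q.range := by
  obtain ⟨g, χ, hg⟩ := p
  obtain ⟨g', χ', hg'⟩ := q
  obtain ⟨rfl, h2⟩ := GermPair.rel_iff.1 h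
  exact act_congr _ _ h2

/-- The inverse `(g⁻¹, χ(g⁻¹ · g))` of `(g, χ)`. -/
def GermPair.inv (p : GermPair S) : GermPair S := ⟨p.elt.inv, p.range, act_inv_mem p.mem⟩

open Classical in
/-- The product `(gh, ψ)` of `(g, χ)` and `(h, ψ)` if `χ = ψ(h⁻¹ · h)`; the value is immaterial
otherwise. -/
noncomputable def GermPair.mul (p q : GermPair S) : GermPair S :=
  if h : p.chi = q.range then ⟨p.elt.comp q.elt, q.chi, comp_mem q.mem (by
    have h1 := p.mem
    rw [h] at h1
    exact h1)⟩ else q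

theorem GermPair.mul_eq {p q : GermPair S} (h : p.chi = q.range) :
    p.mul q = ⟨p.elt.comp q.elt, q.chi, comp_mem q.mem (by
      have h1 := p.mem
      rw [h] at h1
      exact h1)⟩ := dif_pos h

variable (S) in
/-- The set of arrows of the groupoid `𝒢(S)`: the germs `[g, χ]`. -/
def GermGroupoid : Type _ := Quotient (germSetoid (S := S))

/-- The germ `[g, χ]`. -/
def germ (g : LeftHull S) (χ : Omega S) (h : χ.val (dom g) = true) : GermGroupoid S :=
  Quotient.mk _ ⟨g, χ, h⟩

/-- The set `D(g, U) = {[g, χ] | χ ∈ U}`. -/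
def germSet (g : LeftHull S) (U : Set (Omega S)) : Set (GermGroupoid S) :=
  {a | ∃ χ ∈ U, ∃ h : χ.val (dom g) = true, germ g χ h = a}

/-- The topology on `𝒢(S)` with the sets `D(g, U)`, `U` open, as a basis. -/
instance : TopologicalSpace (GermGroupoid S) :=
  TopologicalSpace.generateFrom {W | ∃ g U, IsOpen U ∧ W = germSet g U}

theorem germ_eq_iff {g h : LeftHull S} {χ ψ : Omega S} (hg : χ.val (dom g) = true)
    (hh : ψ.val (dom h) = true) :
    germ g χ hg = germ h ψ hh ↔ χ = ψ ∧ ∀ᶠ s in χ.near, g.1 s = h.1 s :=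
  Quotient.eq.trans (GermPair.rel_iff (p := ⟨g, χ, hg⟩) (q := ⟨h, ψ, hh⟩))

theorem GermPair.inv_congr {p q : GermPair S} (h : p.Rel q) : p.inv.Rel q.inv := by
  have hr := GermPair.range_congr h
  obtain ⟨g, χ, hg⟩ := p
  obtain ⟨g', χ', hg'⟩ := q
  obtain ⟨rfl, h2⟩ := GermPair.rel_iff.1 h
  refine GermPair.rel_iff.2 ⟨hr, ?_⟩
  filter_upwards [near_act_inv hg h2] with t ⟨s, h3, h4⟩
  change g.1.symm t = g'.1.symm t
  rw [(PEquiv.eq_some_iff g.1).2 h3]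
  exact ((PEquiv.eq_some_iff g'.1).2 (h4 ▸ h3)).symm

theorem GermPair.mul_congr {p p' q q' : GermPair S} (hp : p.Rel p') (hq : q.Rel q') :
    (p.mul q).Rel (p'.mul q') := by
  have hr := GermPair.range_congr hq
  obtain ⟨g, χ, hg⟩ := p
  obtain ⟨g', χ', hg'⟩ := p'
  obtain ⟨h, ψ, hh⟩ := q
  obtain ⟨h', ψ', hh'⟩ := q'
  obtain ⟨hχ, h2⟩ := GermPair.rel_iff.1 hp
  obtain ⟨hψ, h3⟩ := GermPair.rel_iff.1 hq
  simp only at hχ hψ h2 h3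
  subst hχ
  subst hψ
  by_cases hc : χ = (⟨h, ψ, hh⟩ : GermPair S).range
  · rw [GermPair.mul, dif_pos hc, GermPair.mul, dif_pos (hc.trans hr)]
    refine GermPair.rel_iff.2 ⟨rfl, ?_⟩
    simp only
    rw [hc] at h2
    filter_upwards [near_act hh h2, h3] with s ⟨t, h4, h5⟩ h6
    refine Option.ext fun r => ?_
    rw [comp_apply_eq_some, comp_apply_eq_some, ← h6, h4]
    simp [h5]
  · rw [GermPair.mul, dif_neg hc, GermPair.mul, dif_neg fun h => hc (h.trans hr.symm)]
    exact hq

/-- The groupoid structure of `𝒢(S)`, with unit space `Ω(S)`. -/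
noncomputable instance : ArrowGroupoid (GermGroupoid S) (Omega S) where
  src := Quotient.lift (fun p => p.chi) fun _ _ h => h.1
  rng := Quotient.lift (fun p => p.range) fun _ _ h => GermPair.range_congr h
  unit χ := germ LeftHull.one χ (one_mem χ)
  inv := Quotient.map GermPair.inv fun _ _ h => GermPair.inv_congr h
  mul := Quotient.map₂ GermPair.mul fun _ _ h _ _ h' => GermPair.mul_congr h h'
  src_unit χ := rfl
  rng_unit χ := act_one χ
  src_inv a := Quotient.inductionOn a fun _ => rfl
  rng_inv a := Quotient.inductionOn a fun p => act_inv_act p.mem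
  src_mul a b := Quotient.inductionOn₂ a b fun p q (h : p.chi = q.range) => by
    change (p.mul q).chi = q.chi
    rw [GermPair.mul_eq h]
  rng_mul a b := Quotient.inductionOn₂ a b fun p q (h : p.chi = q.range) => by
    change (p.mul q).range = p.range
    obtain ⟨g, χ, hg⟩ := p
    simp only at h
    subst h
    rw [GermPair.mul_eq rfl]
    exact act_comp q.mem hg
  assoc a b c := Quotient.inductionOn₃ a b c
    fun p q r (h : p.chi = q.range) (h' : q.chi = r.range) => by
      obtain ⟨g, χ, hg⟩ := p
      obtain ⟨g', χ', hg'⟩ := q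
      simp only at h h'
      subst h'
      subst h
      change (Quotient.mk _ _ : GermGroupoid S) = Quotient.mk _ _
      have e1 : (GermPair.mk g' r.range hg').mul r = ⟨g'.comp r.elt, r.chi, comp_mem r.mem hg'⟩ :=
        GermPair.mul_eq rfl
      have e2 : (GermPair.mk g (GermPair.mk g' r.range hg').range hg).mul ⟨g', r.range, hg'⟩
          = ⟨g.comp g', r.range, comp_mem hg' hg⟩ := GermPair.mul_eq rfl
      rw [e1, e2]
      refine congrArg _ ((GermPair.mul_eq rfl).trans (Eq.trans ?_
        (GermPair.mul_eq (act_comp r.mem hg').symm).symm))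
      exact GermPair.ext (Subtype.ext (PEquiv.trans_assoc _ _ _).symm) rfl
  unit_mul a := Quotient.inductionOn a fun p => by
    change (Quotient.mk _ (GermPair.mul ⟨LeftHull.one, p.range, one_mem _⟩ p) : GermGroupoid S)
      = Quotient.mk _ _
    rw [GermPair.mul_eq rfl]
    exact congrArg _ (GermPair.ext (Subtype.ext (PEquiv.trans_refl _)) rfl)
  mul_unit a := Quotient.inductionOn a fun p => by
    change (Quotient.mk _ (GermPair.mul p ⟨LeftHull.one, p.chi, one_mem _⟩) : GermGroupoid S)
      = Quotient.mk _ _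
    rw [GermPair.mul_eq (act_one p.chi).symm]
    exact congrArg _ (GermPair.ext (Subtype.ext (PEquiv.refl_trans _)) rfl)
  inverse_mul a := Quotient.inductionOn a fun p => by
    change (Quotient.mk _ (p.inv.mul p) : GermGroupoid S) = germ LeftHull.one p.chi (one_mem _)
    rw [GermPair.mul_eq (p := p.inv) rfl]
    refine (germ_eq_iff _ _).2 ⟨rfl, ?_⟩
    filter_upwards [Omega.near_dom p.mem] with s ⟨t, ht⟩
    change _ = some s
    exact comp_apply_eq_some.2 ⟨t, ht, (PEquiv.eq_some_iff p.elt.1).2 ht⟩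
  mul_inverse a := Quotient.inductionOn a fun p => by
    change (Quotient.mk _ (p.mul p.inv) : GermGroupoid S) = germ LeftHull.one p.range (one_mem _)
    rw [GermPair.mul_eq (q := p.inv) (act_inv_act p.mem).symm]
    refine (germ_eq_iff _ _).2 ⟨rfl, ?_⟩
    filter_upwards [near_act_inv p.mem (Filter.Eventually.of_forall fun _ => trivial)]
      with t ⟨s, hs, _⟩
    change _ = some t
    exact comp_apply_eq_some.2 ⟨s, (PEquiv.eq_some_iff p.elt.1).2 hs, hs⟩

end Hull

/-! ### The étale topology of `𝒢(S)` -/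

section Topology

variable {S : Type*} [LeftCancelMonoid S]

open Constructible ArrowGroupoid

theorem src_germ (g : LeftHull S) (χ : Omega S) (h : χ.val (dom g) = true) :
    src (germ g χ h) = χ := rfl

theorem rng_germ (g : LeftHull S) (χ : Omega S) (h : χ.val (dom g) = true) :
    rng (germ g χ h) = act g χ h := rfl

theorem inv_germ (g : LeftHull S) (χ : Omega S) (h : χ.val (dom g) = true) :
    inv (germ g χ h) = germ g.inv (act g χ h) (act_inv_mem h) := rfl

theorem mul_germ (g h : LeftHull S) (χ : Omega S) (hh : χ.val (dom h) = true)
    (hg : (act h χ hh).val (dom g) = true) :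
    mul (germ g (act h χ hh) hg) (germ h χ hh) = germ (g.comp h) χ (comp_mem hh hg) :=
  congrArg (Quotient.mk _) (GermPair.mul_eq (p := ⟨g, act h χ hh, hg⟩) (q := ⟨h, χ, hh⟩) rfl)

theorem exists_germ (a : GermGroupoid S) : ∃ g χ h, germ (S := S) g χ h = a :=
  Quotient.inductionOn a fun p => ⟨p.elt, p.chi, p.mem, rfl⟩

/-- The clopen set of `χ ∈ Ω(S)` with `χ(g⁻¹g) = 1`. -/
abbrev DomSpace (g : LeftHull S) : Type _ := {χ : Omega S // χ.val (dom g) = true}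

/-- The section `χ ↦ [g, χ]`. -/
def sec (g : LeftHull S) (χ : DomSpace g) : GermGroupoid S := germ g χ.1 χ.2

theorem isOpen_dom (g : LeftHull S) : IsOpen {χ : Omega S | χ.val (dom g) = true} :=
  (isOpen_discrete {true}).preimage (Omega.continuous_val (dom g))

theorem isOpen_germSet (g : LeftHull S) {U : Set (Omega S)} (hU : IsOpen U) :
    IsOpen (germSet g U) := TopologicalSpace.isOpen_generateFrom_of_mem ⟨g, U, hU, rfl⟩

theorem isOpen_barOne (A : Set S) : IsOpen {χ : Omega S | χ.BarOne A} := by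
  have : {χ : Omega S | χ.BarOne A} = ⋃ (X : Constructible S) (F : Finset (Constructible S))
      (_ : A = diffSet X F), ({χ : Omega S | χ.val X = true} ∩
        ⋂ Y ∈ F, {χ : Omega S | χ.val Y = false}) := by
    ext χ
    simp only [Omega.BarOne, Set.mem_ofPred_eq, Set.mem_iUnion, Set.mem_inter_iff, Set.mem_iInter,
      exists_prop]
  rw [this]
  refine isOpen_iUnion fun X => isOpen_iUnion fun F => isOpen_iUnion fun _ => ?_
  refine IsOpen.inter ((isOpen_discrete {true}).preimage (Omega.continuous_val X)) ?_
  exact isOpen_biInter_finset fun Y _ =>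
    (isOpen_discrete {false}).preimage (Omega.continuous_val Y)

theorem isOpen_near (p : S → Prop) : IsOpen {χ : Omega S | ∀ᶠ s in χ.near, p s} := by
  refine isOpen_iff_forall_mem_open.2 fun χ hχ => ?_
  obtain ⟨A, hA, hp⟩ := Omega.exists_barOne hχ
  exact ⟨_, fun η hη => (Omega.barOne_mem_near hη).mono hp, isOpen_barOne A, hA⟩

theorem continuous_sec (g : LeftHull S) : Continuous (sec g) := by
  refine continuous_generateFrom_iff.2 ?_
  rintro _ ⟨h, U, hU, rfl⟩
  have : sec g ⁻¹' germSet h U = Subtype.val ⁻¹' (U ∩ {χ : Omega S | χ.val (dom h) = true} ∩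
      {χ : Omega S | ∀ᶠ s in χ.near, h.1 s = g.1 s}) := by
    ext χ
    constructor
    · rintro ⟨ψ, hψU, hψ, e⟩
      obtain ⟨e1, e2⟩ := (germ_eq_iff hψ χ.2).1 e
      rw [e1] at hψU hψ e2
      exact ⟨⟨hψU, hψ⟩, e2⟩
    · rintro ⟨⟨h1, h2⟩, h3⟩
      exact ⟨χ.1, h1, h2, (germ_eq_iff h2 χ.2).2 ⟨rfl, h3⟩⟩
  rw [this]
  exact ((hU.inter (isOpen_dom h)).inter (isOpen_near _)).preimage continuous_subtype_val

theorem sec_image (g : LeftHull S) (V : Set (DomSpace g)) :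
    sec g '' V = germSet g (Subtype.val '' V) := by
  ext a
  constructor
  · rintro ⟨χ, hχ, rfl⟩
    exact ⟨χ.1, ⟨χ, hχ, rfl⟩, χ.2, rfl⟩
  · rintro ⟨_, ⟨χ, hχ, rfl⟩, h, rfl⟩
    exact ⟨χ, hχ, rfl⟩

theorem isOpenMap_sec (g : LeftHull S) : IsOpenMap (sec g) := fun V hV => by
  rw [sec_image]
  exact isOpen_germSet g ((isOpen_dom g).isOpenMap_subtype_val V hV)

theorem continuous_of_sec {Z : Type*} [TopologicalSpace Z] {f : GermGroupoid S → Z}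
    (h : ∀ g, Continuous fun χ => f (sec g χ)) : Continuous f := by
  refine continuous_def.2 fun W hW => ?_
  have : f ⁻¹' W = ⋃ g, sec g '' ((fun χ => f (sec g χ)) ⁻¹' W) := by
    ext a
    obtain ⟨g, χ, hχ, rfl⟩ := exists_germ a
    simp only [Set.mem_preimage, Set.mem_iUnion]
    constructor
    · intro h1
      exact ⟨g, ⟨χ, hχ⟩, h1, rfl⟩
    · rintro ⟨g', ψ, h1, h2⟩
      rw [← h2]
      exact h1
  rw [this]
  exact isOpen_iUnion fun g => isOpenMap_sec g _ (hW.preimage (h g))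

theorem continuous_src : Continuous (src : GermGroupoid S → Omega S) :=
  continuous_of_sec fun _ => continuous_subtype_val

theorem continuous_act (g : LeftHull S) : Continuous fun χ : DomSpace g => act g χ.1 χ.2 :=
  Continuous.subtype_mk (Continuous.subtype_mk (continuous_pi fun X =>
    (Omega.continuous_val (preimage g X)).comp continuous_subtype_val) _) _

theorem continuous_inv_germ : Continuous (inv : GermGroupoid S → GermGroupoid S) :=
  continuous_of_sec fun g => (continuous_sec g.inv).comp
    ((continuous_act g).subtype_mk fun χ => act_inv_mem χ.2)

theorem inv_inv_germ (a : GermGroupoid S) : inv (inv a) = a := by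
  obtain ⟨g, χ, h, rfl⟩ := exists_germ a
  rw [inv_germ, inv_germ]
  exact (germ_eq_iff _ _).2 ⟨act_inv_act h, Filter.Eventually.of_forall fun _ => rfl⟩

/-- The inversion of `𝒢(S)` as a homeomorphism. -/
noncomputable def invHomeomorph : GermGroupoid S ≃ₜ GermGroupoid S where
  toFun := inv
  invFun := inv
  left_inv := inv_inv_germ
  right_inv := inv_inv_germ
  continuous_toFun := continuous_inv_germ
  continuous_invFun := continuous_inv_germ

theorem isOpenMap_src : IsOpenMap (src : GermGroupoid S → Omega S) := fun W hW => by
  have : src '' W = ⋃ g : LeftHull S, Subtype.val '' (sec g ⁻¹' W) := by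
    ext χ
    simp only [Set.mem_iUnion]
    constructor
    · rintro ⟨a, ha, rfl⟩
      obtain ⟨g, χ, hχ, rfl⟩ := exists_germ a
      exact ⟨g, ⟨χ, hχ⟩, ha, rfl⟩
    · rintro ⟨g, ψ, h1, rfl⟩
      exact ⟨_, h1, rfl⟩
  rw [this]
  exact isOpen_iUnion fun g =>
    (isOpen_dom g).isOpenMap_subtype_val _ (hW.preimage (continuous_sec g))

theorem src_isLocalHomeomorph_germ : IsLocalHomeomorph (src : GermGroupoid S → Omega S) := by
  refine isLocalHomeomorph_iff_isOpenEmbedding_restrict.2 fun a => ?_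
  obtain ⟨g, χ, hχ, rfl⟩ := exists_germ a
  have hO : IsOpen (germSet g (Set.univ : Set (Omega S))) := isOpen_germSet g isOpen_univ
  refine ⟨germSet g Set.univ, hO.mem_nhds ⟨χ, trivial, hχ, rfl⟩, ?_⟩
  refine Topology.IsOpenEmbedding.of_continuous_injective_isOpenMap
    (continuous_src.comp continuous_subtype_val) ?_
    (isOpenMap_src.comp hO.isOpenMap_subtype_val)
  rintro ⟨_, χ, _, h, rfl⟩ ⟨_, ψ, _, h', rfl⟩ (e : χ = ψ)
  subst e
  rfl

theorem rng_isLocalHomeomorph_germ : IsLocalHomeomorph (rng : GermGroupoid S → Omega S) := by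
  have : (rng : GermGroupoid S → Omega S) = src ∘ invHomeomorph :=
    funext fun a => (src_inv a).symm
  rw [this]
  exact src_isLocalHomeomorph_germ.comp invHomeomorph.isLocalHomeomorph

theorem continuous_mul_germ : Continuous
    fun p : {p : GermGroupoid S × GermGroupoid S // src p.1 = rng p.2} => mul p.1.1 p.1.2 := by
  refine continuous_def.2 fun W hW => isOpen_iff_forall_mem_open.2 ?_
  rintro ⟨⟨a, b⟩, hab⟩ hW'
  obtain ⟨h, χ, hh, rfl⟩ := exists_germ b
  obtain ⟨g, ψ, hg, rfl⟩ := exists_germ a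
  obtain rfl : ψ = act h χ hh := hab
  have hV : IsOpen (Subtype.val '' (sec (g.comp h) ⁻¹' W)) :=
    (isOpen_dom (g.comp h)).isOpenMap_subtype_val _ (hW.preimage (continuous_sec _))
  refine ⟨(fun p => p.1.1) ⁻¹' germSet g Set.univ ∩
    (fun p => p.1.2) ⁻¹' germSet h (Subtype.val '' (sec (g.comp h) ⁻¹' W)), ?_, ?_, ?_⟩
  · rintro ⟨⟨_, _⟩, hab⟩ ⟨⟨ψ', -, hg', rfl⟩, ⟨_, ⟨η, hη, rfl⟩, hh', rfl⟩⟩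
    obtain rfl : ψ' = act h η.1 hh' := hab
    change mul (germ g _ _) (germ h _ _) ∈ W
    rw [mul_germ]
    exact hη
  · exact ((isOpen_germSet g isOpen_univ).preimage
      (continuous_fst.comp continuous_subtype_val)).inter
      ((isOpen_germSet h hV).preimage (continuous_snd.comp continuous_subtype_val))
  · change mul (germ g _ _) (germ h _ _) ∈ W at hW'
    rw [mul_germ] at hW'
    exact ⟨⟨_, trivial, hg, rfl⟩, ⟨χ, ⟨⟨χ, comp_mem hh hg⟩, hW', rfl⟩, hh, rfl⟩⟩

instance : T2Space (Semicharacter S) :=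
  inferInstanceAs (T2Space {χ : Constructible S → Bool //
    (∃ X, χ X = true) ∧ ∀ X Y, χ (inter X Y) = (χ X && χ Y)})

instance : T2Space (Omega S) :=
  inferInstanceAs (T2Space {χ : Semicharacter S // χ ∈ closure (Set.range (charAt (S := S)))})

instance : CompactSpace (Semicharacter S) := by
  have hcl : IsClosed {χ : Constructible S → Bool |
      (∃ X, χ X = true) ∧ ∀ X Y, χ (inter X Y) = (χ X && χ Y)} := by
    have : {χ : Constructible S → Bool |
        (∃ X, χ X = true) ∧ ∀ X Y, χ (inter X Y) = (χ X && χ Y)} =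
        {χ | χ (top S) = true} ∩ ⋂ (X) (Y), {χ | χ (inter X Y) = (χ X && χ Y)} := by
      ext χ
      simp only [Set.mem_ofPred_eq, Set.mem_inter_iff, Set.mem_iInter]
      constructor
      · rintro ⟨⟨X, hX⟩, h⟩
        refine ⟨?_, h⟩
        have h1 : inter X (top S) = X := Subtype.ext (Set.inter_univ _)
        have h2 := h X (top S)
        rw [h1, hX] at h2
        simpa using h2.symm
      · rintro ⟨h1, h2⟩
        exact ⟨⟨_, h1⟩, h2⟩
    rw [this]
    refine (isClosed_eq (continuous_apply _) continuous_const).inter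
      (isClosed_iInter fun X => isClosed_iInter fun Y => isClosed_eq (continuous_apply _) ?_)
    have h1 : Continuous fun p : Bool × Bool => (p.1 && p.2) := continuous_of_discreteTopology
    have h2 : Continuous fun χ : Constructible S → Bool => (χ X, χ Y) :=
      (continuous_apply X).prodMk (continuous_apply Y)
    exact h1.comp h2
  exact isCompact_iff_compactSpace.1 hcl.isCompact

instance : CompactSpace (Omega S) :=
  isCompact_iff_compactSpace.1 (isClosed_closure (s := Set.range (charAt (S := S)))).isCompact

/-- `𝒢(S)` is an étale groupoid with compact Hausdorff unit space `Ω(S)`. -/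
noncomputable instance : EtaleGroupoid (GermGroupoid S) (Omega S) where
  continuous_inv := continuous_inv_germ
  continuous_mul := continuous_mul_germ
  unit_isEmbedding := Function.LeftInverse.isEmbedding (f := src) (fun χ => src_unit χ)
    continuous_src ((continuous_sec LeftHull.one).comp (continuous_id.subtype_mk one_mem))
  t2_units := inferInstance
  locallyCompact_units := inferInstance
  src_isLocalHomeomorph := src_isLocalHomeomorph_germ
  rng_isLocalHomeomorph := rng_isLocalHomeomorph_germ

end Topology

/-! ### The reduced C*-algebra of `S` -/

section Semigroup

variable {S : Type*} [LeftCancelMonoid S]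

theorem orthonormal_delta_mul (s : S) : Orthonormal ℂ fun t : S => delta (s * t) := by
  classical
  rw [orthonormal_iff_ite]
  intro t u
  unfold delta
  rw [lp.inner_single_left]
  simp only [lp.single_apply, Pi.single_apply, mul_left_cancel_iff]
  split_ifs <;> simp_all

/-- The operator `λ_s` of the left regular representation on `ℓ²(S)`, `λ_s δ_t = δ_{st}`. -/
noncomputable def leftRegular (s : S) : L2 S →L[ℂ] L2 S :=
  (orthonormal_delta_mul s).orthogonalFamily.linearIsometry.toContinuousLinearMap

theorem leftRegular_delta (s t : S) : leftRegular s (delta t) = delta (s * t) := by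
  classical
  have h := (orthonormal_delta_mul s).orthogonalFamily.linearIsometry_apply_single (i := t) (1 : ℂ)
  rw [LinearIsometry.toSpanSingleton_apply, one_smul] at h
  rw [← h]
  unfold leftRegular delta
  congr!

variable (S) in
/-- The reduced C*-algebra `C*_r(S)`, generated by the operators `λ_s`, `s ∈ S`. -/
noncomputable def reducedSemigroupAlgebra : StarSubalgebra ℂ (L2 S →L[ℂ] L2 S) :=
  (StarAlgebra.adjoin ℂ (Set.range (leftRegular (S := S)))).topologicalClosure

open Constructible in
theorem point_mem_dom_ofElem (s t : S) :
    (Omega.point t).val (dom (LeftHull.ofElem s)) = true :=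
  (Omega.val_point t _).2 (mem_dom.2 ⟨s * t, rfl⟩)

/-- The arrow `[s, χ_e]` of `𝒢(S)`, an element of the fibre `𝒢(S)_{χ_e}`. -/
noncomputable def baseArrow (s : S) :
    SrcFiber (GermGroupoid S) (Omega.point (1 : S)) :=
  ⟨germ (LeftHull.ofElem s) (Omega.point 1) (point_mem_dom_ofElem s 1), rfl⟩

end Semigroup

end SemigroupCStar

/-!
`C*_r(𝒢(S))` is the closed linear span of the indicators of the bisections `D(g)`, `g ∈ I_ℓ(S)`:
by Stone–Weierstrass the indicators of constructible ideals span a dense subspace of `C(Ω(S))`.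
On this span the norm is attained at `χ_e`. By C*-regularity, finitely many germs at a given `χ`
are told apart, and found to be defined or not, at a single point `s ∈ S` arbitrarily close to `χ`.
Hence composing germs with right translation by `s` preserves their Gram matrix while moving them
from `χ` to `χ_e`, and a vector at `χ` is carried to one of the same norm at `χ_e` compatibly with
the action of the indicators, so that `‖ρ_χ(a)‖ ≤ ‖ρ_{χ_e}(a)‖`. It remains to note that under `U`
the operator `ρ_{χ_e}(1_{D(s)})` becomes `λ_s`, and that the `1_{D(s)}` generate.
-/

namespace SemigroupCStar

theorem norm_linearCombination_eq_of_inner_eq {𝕜 E F α : Type*} [RCLike 𝕜]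
    [NormedAddCommGroup E] [InnerProductSpace 𝕜 E] [NormedAddCommGroup F] [InnerProductSpace 𝕜 F]
    {v : α → E} {w : α → F} {c : α →₀ 𝕜}
    (h : ∀ a ∈ c.support, ∀ b ∈ c.support, inner 𝕜 (v a) (v b) = inner 𝕜 (w a) (w b)) :
    ‖Finsupp.linearCombination 𝕜 v c‖ = ‖Finsupp.linearCombination 𝕜 w c‖ := by
  have inner_eq : inner 𝕜 (Finsupp.linearCombination 𝕜 v c) (Finsupp.linearCombination 𝕜 v c) =
      inner 𝕜 (Finsupp.linearCombination 𝕜 w c) (Finsupp.linearCombination 𝕜 w c) := by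
    simp only [Finsupp.linearCombination_apply, Finsupp.sum, sum_inner, inner_sum,
      inner_smul_left, inner_smul_right]
    exact Finset.sum_congr rfl fun a ha => congrArg (c a * ·) <|
      Finset.sum_congr rfl fun b hb => by rw [h b hb a ha]
  rw [norm_eq_sqrt_re_inner (𝕜 := 𝕜), norm_eq_sqrt_re_inner (𝕜 := 𝕜), inner_eq]

theorem opNorm_le_of_dense_span {𝕜 E F α : Type*} [NontriviallyNormedField 𝕜]
    [SeminormedAddCommGroup E] [NormedSpace 𝕜 E] [SeminormedAddCommGroup F] [NormedSpace 𝕜 F]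
    {v : α → E} (hv : Dense (Submodule.span 𝕜 (Set.range v) : Set E)) {A : E →L[𝕜] F} {M : ℝ}
    (hM : 0 ≤ M) (h : ∀ c : α →₀ 𝕜,
      ‖A (Finsupp.linearCombination 𝕜 v c)‖ ≤ M * ‖Finsupp.linearCombination 𝕜 v c‖) :
    ‖A‖ ≤ M := by
  refine A.opNorm_le_bound hM fun ξ => hv.induction (fun η hη => ?_)
    (isClosed_le A.continuous.norm (continuous_norm.const_mul M)) ξ
  obtain ⟨c, rfl⟩ := Finsupp.mem_span_range_iff_exists_finsupp.1 hη
  exact h c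

section Delta

variable {ι κ : Type*}

theorem coe_default_hilbertBasis : ⇑(default : HilbertBasis ι ℂ (L2 ι)) = delta := by
  classical
  funext i
  rw [← HilbertBasis.repr_symm_single]
  unfold delta
  congr!

theorem orthonormal_delta : Orthonormal ℂ (delta : ι → L2 ι) := by
  rw [← coe_default_hilbertBasis]
  exact HilbertBasis.orthonormal _

theorem dense_span_delta :
    Dense (Submodule.span ℂ (Set.range (delta : ι → L2 ι)) : Set (L2 ι)) := by
  rw [Submodule.dense_iff_topologicalClosure_eq_top, ← coe_default_hilbertBasis]
  exact HilbertBasis.dense_span _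

theorem inner_delta (i : ι) (ξ : L2 ι) : inner ℂ (delta i) ξ = ξ i := by
  rw [← coe_default_hilbertBasis, ← HilbertBasis.repr_apply_apply]
  rfl

theorem delta_apply [DecidableEq ι] (i j : ι) : (delta i : L2 ι) j = if j = i then 1 else 0 := by
  rw [← inner_delta, orthonormal_iff_ite.1 orthonormal_delta]

theorem clm_ext_delta {E : Type*} [NormedAddCommGroup E] [NormedSpace ℂ E] {A B : L2 ι →L[ℂ] E}
    (h : ∀ i, A (delta i) = B (delta i)) : A = B :=
  ContinuousLinearMap.ext_on dense_span_delta (Set.forall_mem_range.2 h)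

theorem exists_unitary_of_equiv (e : ι ≃ κ) :
    ∃ U : L2 ι ≃ₗᵢ[ℂ] L2 κ, ∀ i, U (delta i) = delta (e i) := by
  have dense : ⊤ ≤ (Submodule.span ℂ (Set.range ((delta : κ → L2 κ) ∘ e))).topologicalClosure := by
    rw [e.surjective.range_comp,
      ← Submodule.dense_iff_topologicalClosure_eq_top.1 dense_span_delta]
  let b := HilbertBasis.mk (orthonormal_delta.comp e e.injective) dense
  refine ⟨b.repr.symm, fun i => ?_⟩
  have repr_delta : b.repr (delta (e i)) = delta i := by
    rw [← coe_default_hilbertBasis (ι := ι)]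
    have : b i = delta (e i) := congrFun (HilbertBasis.coe_mk _ _) i
    classical rw [← this, b.repr_self, coe_default_hilbertBasis]
    unfold delta
    congr!
  rw [← repr_delta, LinearIsometryEquiv.symm_apply_apply]

end Delta

section OpProduct

variable {X : Type*} {ι : X → Type*}

theorem OpProduct.ext {a b : OpProduct ι}
    (h : ∀ x, OpProduct.eval x a = OpProduct.eval x b) : a = b :=
  lp.ext (funext h)

theorem OpProduct.norm_eval_le (x : X) (a : OpProduct ι) :
    ‖OpProduct.eval x a‖ ≤ ‖a‖ :=
  lp.norm_apply_le_norm (E := fun x : X => L2 (ι x) →L[ℂ] L2 (ι x)) ENNReal.top_ne_zero a x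

theorem OpProduct.continuous_eval (x : X) : Continuous (OpProduct.eval (ι := ι) x) :=
  AddMonoidHomClass.continuous_of_bound _ 1 fun a =>
    (OpProduct.norm_eval_le x a).trans_eq (one_mul _).symm

theorem OpProduct.norm_le {a : OpProduct ι} {C : ℝ} (hC : 0 ≤ C)
    (h : ∀ x, ‖OpProduct.eval x a‖ ≤ C) : ‖a‖ ≤ C :=
  lp.norm_le_of_forall_le (E := fun x : X => L2 (ι x) →L[ℂ] L2 (ι x)) hC h

end OpProduct

section Groupoid

variable {G X : Type*}

open ArrowGroupoid

theorem mul_inv_eq_iff [ArrowGroupoid G X] {j k a : G} (hjk : src j = src k)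
    (hak : src a = rng k) : mul j (inv k) = a ↔ j = mul a k := by
  constructor
  · rintro rfl
    rw [assoc _ _ _ (hjk.trans (rng_inv k).symm) (src_inv k), inverse_mul, ← hjk, mul_unit]
  · rintro rfl
    rw [assoc _ _ _ hak (rng_inv k).symm, mul_inverse, ← hak, mul_unit]

variable [TopologicalSpace G] [TopologicalSpace X] [EtaleGroupoid G X] {x : X}

theorem rho_apply_eq_tsum (f : Cc G) (ξ : L2 (SrcFiber G x)) (j : SrcFiber G x) :
    rho x f ξ j = ∑' k : SrcFiber G x, (f : G → ℂ) (mul j.1 (inv k.1)) * ξ k :=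
  convFormula_eq _ _ _ _

theorem rho_delta_apply (f : Cc G) (k j : SrcFiber G x) :
    rho x f (delta k) j = (f : G → ℂ) (mul j.1 (inv k.1)) := by
  classical
  rw [rho_apply_eq_tsum, tsum_eq_single k fun l hl => by simp [delta_apply, hl]]
  simp [delta_apply]

theorem src_mul_inv (j k : SrcFiber G x) : src (mul j.1 (inv k.1)) = rng k.1 := by
  rw [src_mul _ _ (by rw [rng_inv, j.2, k.2]), src_inv]

theorem rho_delta_eq_zero {f : Cc G} {k : SrcFiber G x}
    (hf : ∀ b, src b = rng k.1 → (f : G → ℂ) b = 0) : rho x f (delta k) = 0 := by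
  ext j
  rw [rho_delta_apply, hf _ (src_mul_inv j k)]
  rfl

theorem rho_delta_eq_smul {f : Cc G} {k : SrcFiber G x} {a : G} (ha : src a = rng k.1)
    (hf : ∀ b, src b = rng k.1 → b ≠ a → (f : G → ℂ) b = 0) :
    rho x f (delta k) =
      (f : G → ℂ) a • delta (⟨mul a k.1, (src_mul _ _ ha).trans k.2⟩ : SrcFiber G x) := by
  classical
  ext j
  rw [rho_delta_apply, lp.coeFn_smul, Pi.smul_apply, delta_apply]
  by_cases h : mul j.1 (inv k.1) = a
  · rw [h, if_pos (Subtype.ext ((mul_inv_eq_iff (j.2.trans k.2.symm) ha).1 h)), smul_eq_mul,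
      mul_one]
  · rw [hf _ (src_mul_inv j k) h, if_neg, smul_zero]
    exact fun hj => h ((mul_inv_eq_iff (j.2.trans k.2.symm) ha).2 (congrArg Subtype.val hj))

variable (G) in
/-- The map `f ↦ (ρ_x(f))_x` as a linear map. -/
noncomputable def regularFamilyₗ : Cc G →ₗ[ℂ] OpProduct (SrcFiber G : X → Type _) where
  toFun := regularFamily
  map_add' f f' := OpProduct.ext fun x => clm_ext_delta fun k => by
    ext j
    rw [map_add, add_apply, lp.coeFn_add, Pi.add_apply]
    exact (rho_delta_apply _ k j).trans
      (congrArg₂ (· + ·) (rho_delta_apply f k j) (rho_delta_apply f' k j)).symm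
  map_smul' c f := OpProduct.ext fun x => clm_ext_delta fun k => by
    ext j
    rw [RingHom.id_apply, map_smul, smul_apply, lp.coeFn_smul, Pi.smul_apply]
    exact (rho_delta_apply _ k j).trans (congrArg (c • ·) (rho_delta_apply f k j)).symm

theorem norm_regularFamily_le {f : Cc G} {W : Set G} {C : ℝ} (hC : 0 ≤ C)
    (hs : Set.InjOn src W) (hr : Set.InjOn rng W) (h0 : ∀ g ∉ W, (f : G → ℂ) g = 0)
    (hf : ∀ g, ‖(f : G → ℂ) g‖ ≤ C) : ‖regularFamily f‖ ≤ C := by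
  have hW {g : G} (hg : (f : G → ℂ) g ≠ 0) : g ∈ W := not_imp_comm.1 (h0 g) hg
  have composable {x : X} (j k : SrcFiber G x) : src j.1 = rng (inv k.1) := by
    rw [rng_inv, j.2, k.2]
  have row {x : X} (j : SrcFiber G x) :
      {k : SrcFiber G x | (f : G → ℂ) (mul j.1 (inv k.1)) ≠ 0}.encard ≤ (1 : ℕ) := by
    refine Set.encard_le_one_iff.2 fun k k' hk hk' => (fiberEquiv j).symm.injective ?_
    have e : mul j.1 (inv k.1) = mul j.1 (inv k'.1) :=
      hr (hW hk) (hW hk') (by rw [rng_mul _ _ (composable j k), rng_mul _ _ (composable j k')])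
    exact Subtype.ext e
  have col {x : X} (k : SrcFiber G x) :
      {j : SrcFiber G x | (f : G → ℂ) (mul j.1 (inv k.1)) ≠ 0}.encard ≤ (1 : ℕ) := by
    refine Set.encard_le_one_iff.2 fun j j' hj hj' => Subtype.ext ?_
    have e : mul j.1 (inv k.1) = mul j'.1 (inv k.1) :=
      hs (hW hj) (hW hj') (by rw [src_mul_inv, src_mul_inv])
    exact ((mul_inv_eq_iff (j.2.trans k.2.symm) (src_mul_inv j' k)).1 e).trans
      ((mul_inv_eq_iff (j'.2.trans k.2.symm) (src_mul_inv j' k)).1 rfl).symm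
  refine OpProduct.norm_le hC fun x => ContinuousLinearMap.opNorm_le_bound _ hC fun ξ =>
    lp.norm_le_of_forall_sum_le (by simp) (by positivity) fun s => ?_
  have schur := kernel_sum_le (fun j k : SrcFiber G x => (f : G → ℂ) (mul j.1 (inv k.1))) 1 C
    (fun _ _ => hf _) row col ξ s
  simp only [← rho_apply_eq_tsum, Nat.cast_one, one_mul] at schur
  exact schur

end Groupoid

section Span

open scoped Pointwise

variable {R A : Type*} [CommSemiring R] [StarRing R]

theorem adjoin_toSubmodule_eq_span [NonUnitalSemiring A] [StarRing A] [Module R A]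
    [IsScalarTower R A A] [SMulCommClass R A A] [StarModule R A] {s : Set A}
    (hmul : ∀ a ∈ s, ∀ b ∈ s, a * b ∈ s) (hstar : ∀ a ∈ s, star a ∈ s) :
    (NonUnitalStarAlgebra.adjoin R s).toSubmodule = Submodule.span R s := by
  let M : Subsemigroup A := ⟨s, fun {a b} ha hb => hmul a ha b hb⟩
  have star_subset : star s ⊆ s := fun a ha => by simpa only [star_star] using hstar _ ha
  rw [NonUnitalStarAlgebra.adjoin_eq_span, Set.union_eq_self_of_subset_right star_subset]
  exact congrArg (Submodule.span R ·) (congrArg SetLike.coe M.closure_eq)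

theorem starAdjoin_toSubmodule_eq_span [Semiring A] [StarRing A] [Algebra R A]
    [StarModule R A] {s : Set A} (hone : 1 ∈ s) (hmul : ∀ a ∈ s, ∀ b ∈ s, a * b ∈ s)
    (hstar : ∀ a ∈ s, star a ∈ s) :
    Subalgebra.toSubmodule (StarAlgebra.adjoin R s).toSubalgebra = Submodule.span R s := by
  let M : Submonoid A := ⟨⟨s, fun {a b} ha hb => hmul a ha b hb⟩, hone⟩
  have star_subset : star s ⊆ s := fun a ha => by simpa only [star_star] using hstar _ ha
  rw [StarAlgebra.adjoin_eq_span, Set.union_eq_self_of_subset_right star_subset]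
  exact congrArg (Submodule.span R ·) (congrArg SetLike.coe M.closure_eq)

end Span

section CompactSupport

variable {Z M : Type*} [TopologicalSpace Z] {V : Set Z}

theorem isOpen_sdiff_of_isCompact (hV : IsOpen V) [T2Space V] {D : Set Z} (hD : IsCompact D)
    (hDV : D ⊆ V) : IsOpen (V \ D) := by
  have isCompact_preimage : IsCompact (Subtype.val ⁻¹' D : Set V) := by
    rwa [Subtype.isCompact_iff, Subtype.image_preimage_coe, Set.inter_eq_self_of_subset_right hDV]
  have isOpen_image := hV.isOpenMap_subtype_val _ isCompact_preimage.isClosed.isOpen_compl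
  rwa [← Set.preimage_compl, Subtype.image_preimage_coe] at isOpen_image

variable [TopologicalSpace M]

theorem continuousOn_indicator_compl [Zero M] {f : Z → M} (hf : ContinuousOn f V) {D : Set Z}
    (hD : IsOpen D) (hDV : D ⊆ V) (hVD : IsOpen (V \ D)) : ContinuousOn (Dᶜ.indicator f) V := by
  have on_D : ContinuousOn (Dᶜ.indicator f) D :=
    continuousOn_const.congr fun a ha => Set.indicator_of_notMem (Set.notMem_compl_iff.2 ha) _
  have on_diff : ContinuousOn (Dᶜ.indicator f) (V \ D) :=
    (hf.mono Set.sdiff_subset).congr fun a ha => Set.indicator_of_mem ha.2 _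
  simpa only [Set.union_sdiff_cancel hDV] using on_D.union_of_isOpen on_diff hD hVD

variable [AddCommMonoid M] {W : AddSubmonoid (Z → M)} {D : V → Set Z}

theorem mem_of_support_subset_finite_iUnion (hV : IsOpen V) [T2Space V]
    (hDo : ∀ a, IsOpen (D a)) (hDc : ∀ a, IsCompact (D a)) (hDV : ∀ a, D a ⊆ V)
    (hDW : ∀ a f, ContinuousOn f V → (D a).indicator f ∈ W) (t : Finset V) {f : Z → M}
    (hf : ContinuousOn f V) (hft : f.support ⊆ ⋃ a ∈ t, D a) : f ∈ W := by
  classical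
  induction t using Finset.induction_on generalizing f with
  | empty =>
    have : f = 0 := by simpa using hft
    exact this ▸ zero_mem W
  | insert a t _ ih =>
    rw [← Set.indicator_self_add_compl (D a) f]
    refine add_mem (hDW a f hf) (ih (continuousOn_indicator_compl hf (hDo a) (hDV a)
      (isOpen_sdiff_of_isCompact hV (hDc a) (hDV a))) ?_)
    rw [Set.support_indicator, Set.inter_comm, ← Set.sdiff_eq, Set.sdiff_subset_iff]
    simpa only [Finset.set_biUnion_insert] using hft

theorem mem_of_eq_zero_off_isCompact (hV : IsOpen V) [T2Space V]
    (hDo : ∀ a, IsOpen (D a)) (hDc : ∀ a, IsCompact (D a)) (hDV : ∀ a, D a ⊆ V)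
    (hDW : ∀ a f, ContinuousOn f V → (D a).indicator f ∈ W) (hD : ∀ a : V, a.1 ∈ D a)
    {K : Set Z} (hK : IsCompact K) (hKV : K ⊆ V) {f : Z → M} (hf : ContinuousOn f V)
    (hfK : ∀ a ∉ K, f a = 0) : f ∈ W := by
  obtain ⟨t, ht⟩ := hK.elim_finite_subcover D hDo fun a ha =>
    Set.mem_iUnion.2 ⟨⟨a, hKV ha⟩, hD _⟩
  exact mem_of_support_subset_finite_iUnion hV hDo hDc hDV hDW t hf
    ((Function.support_subset_iff'.2 hfK).trans ht)

end CompactSupport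

section Isometric

open NonUnitalStarSubalgebra

theorem map_topologicalClosure_of_norm_map {𝕜 A B : Type*} [NormedField 𝕜]
    [NonUnitalNormedRing A] [NormedSpace 𝕜 A] [StarRing A] [ContinuousStar A] [CompleteSpace A]
    [NonUnitalNormedRing B] [NormedSpace 𝕜 B] [StarRing B] [ContinuousStar B]
    {φ : A →⋆ₙₐ[𝕜] B} (hφ : Continuous φ) {M : NonUnitalStarSubalgebra 𝕜 A}
    (norm_map : ∀ a ∈ M.topologicalClosure, ‖φ a‖ = ‖a‖) :
    M.topologicalClosure.map φ = (M.map φ).topologicalClosure := by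
  refine le_antisymm (map_topologicalClosure_le M hφ)
    (topologicalClosure_minimal _ (Set.image_mono M.le_topologicalClosure) ?_)
  have complete : CompleteSpace M.topologicalClosure :=
    M.isClosed_topologicalClosure.completeSpace_coe
  have isometry : Isometry fun a : M.topologicalClosure => φ a :=
    Isometry.of_dist_eq fun a b => by
      rw [dist_eq_norm, ← map_sub, norm_map _ (sub_mem a.2 b.2), Subtype.dist_eq, dist_eq_norm]
  convert isometry.isClosedEmbedding.isClosed_range using 1
  exact Set.image_eq_range _ _

theorem exists_starAlgEquiv_of_injOn {R A B : Type*} [CommSemiring R] [StarRing R]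
    [NonUnitalSemiring A] [StarRing A] [Module R A]
    [Semiring B] [StarRing B] [Algebra R B] [StarModule R B]
    {φ : A →⋆ₙₐ[R] B} {M : NonUnitalStarSubalgebra R A} {N : StarSubalgebra R B}
    (injOn : Set.InjOn φ M) (map_eq : M.map φ = N.toNonUnitalStarSubalgebra) :
    ∃ Φ : M ≃⋆ₐ[R] N, ∀ a, (Φ a : B) = φ a := by
  have map_mem (a : M) : φ a ∈ N := by
    rw [← StarSubalgebra.mem_toNonUnitalStarSubalgebra, ← map_eq]
    exact ⟨a, a.2, rfl⟩
  let f : M →⋆ₙₐ[R] N :=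
    NonUnitalStarAlgHom.codRestrict (φ.comp (NonUnitalStarSubalgebraClass.subtype M))
      N.toNonUnitalStarSubalgebra map_mem
  refine ⟨StarAlgEquiv.ofBijective f ⟨fun a b hab => ?_, fun b => ?_⟩, fun a => rfl⟩
  · exact Subtype.ext (injOn a.2 b.2 (congrArg Subtype.val hab))
  · obtain ⟨a, ha, hab⟩ : b.1 ∈ M.map φ := map_eq ▸ b.2
    exact ⟨⟨a, ha⟩, Subtype.ext hab⟩

end Isometric

variable {S : Type*} [LeftCancelMonoid S]

open Constructible ArrowGroupoid

namespace LeftHull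

theorem comp_assoc (g h k : LeftHull S) : (g.comp h).comp k = g.comp (h.comp k) :=
  Subtype.ext (PEquiv.trans_assoc _ _ _).symm

theorem comp_one (g : LeftHull S) : g.comp one = g :=
  Subtype.ext (PEquiv.refl_trans _)

theorem inv_comp (g h : LeftHull S) : (g.comp h).inv = h.inv.comp g.inv :=
  Subtype.ext (PEquiv.symm_trans_rev _ _)

theorem inv_comp_apply_eq_self_iff {g h : LeftHull S} {s : S} :
    (g.inv.comp h).1 s = some s ↔ ∃ t, g.1 s = some t ∧ h.1 s = some t := by
  rw [comp_apply_eq_some]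
  exact exists_congr fun t => and_comm.trans (and_congr_left' (PEquiv.eq_some_iff g.1))

theorem comp_ofElem_apply_one (g : LeftHull S) (s : S) : (g.comp (ofElem s)).1 1 = g.1 s := by
  change g.1 (s * 1) = _
  rw [mul_one]

theorem apply_mul (g : LeftHull S) {a b : S} (t : S) (h : g.1 a = some b) :
    g.1 (a * t) = some (b * t) := by
  obtain ⟨g, hg⟩ := g
  induction hg generalizing a b with
  | translation s =>
    obtain rfl : s * a = b := Option.some.inj h
    exact congrArg some (mul_assoc s a t).symm
  | trans _ _ ihg ihh =>
    obtain ⟨c, hac, hcb⟩ := (PEquiv.trans_eq_some ..).1 h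
    exact (PEquiv.trans_eq_some ..).2 ⟨c * t, ihg hac, ihh hcb⟩
  | symm _ ih => exact (PEquiv.eq_some_iff _).2 (ih ((PEquiv.eq_some_iff _).1 h))

end LeftHull

namespace Omega

theorem eventually_mem_iff {χ : Omega S} {X : Constructible S} :
    (∀ᶠ s in χ.near, s ∈ X.1) ↔ χ.val X = true := by
  rw [Filter.eventually_congr (χ.near_iff X), Filter.eventually_const]

theorem val_mono {χ : Omega S} {X Y : Constructible S} (hXY : X.1 ⊆ Y.1) (hX : χ.val X = true) :
    χ.val Y = true :=
  eventually_mem_iff.1 ((eventually_mem_iff.2 hX).mono fun _ hs => hXY hs)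

theorem val_dom_comp {χ : Omega S} (g : LeftHull S) {h : LeftHull S} (hh : χ.val (dom h) = true) :
    χ.val (dom (g.comp h)) = (act h χ hh).val (dom g) := by
  rw [act_val]
  refine congrArg χ.val (Subtype.ext (Set.ext fun s => ?_))
  simp only [mem_dom, mem_preimage, comp_apply_eq_some]
  exact ⟨fun ⟨t, u, hu, ht⟩ => ⟨u, hu, t, ht⟩, fun ⟨u, hu, t, ht⟩ => ⟨t, u, hu, ht⟩⟩

theorem val_dom_of_comp {χ : Omega S} {g h : LeftHull S} (hgh : χ.val (dom (g.comp h)) = true) :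
    χ.val (dom h) = true := by
  refine val_mono (fun s hs => mem_dom.2 ?_) hgh
  obtain ⟨t, ht⟩ := mem_dom.1 hs
  exact (comp_apply_eq_some.1 ht).imp fun _ => And.left

theorem eventually_near_point {p : S → Prop} {s : S} (h : ∀ᶠ t in (point s).near, p t) : p s := by
  obtain ⟨W, hW, hWp⟩ := Filter.mem_comap.1 h
  exact hWp (mem_of_mem_nhds hW : charAt s ∈ W)

theorem eventually_fixed_near_point_one_iff {g : LeftHull S} :
    (∀ᶠ t in (point 1).near, g.1 t = some t) ↔ g.1 1 = some 1 :=
  ⟨eventually_near_point, fun h => .of_forall fun t => by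
    simpa only [one_mul] using g.apply_mul t h⟩

end Omega

section GermVec

open Classical in
/-- The basis vector of `ℓ²(𝒢(S)_χ)` at the germ `[g, χ]`, or `0` if `g` has no germ at `χ`. -/
noncomputable def germVec (χ : Omega S) (g : LeftHull S) : L2 (SrcFiber (GermGroupoid S) χ) :=
  if h : χ.val (dom g) = true then delta ⟨germ g χ h, src_germ g χ h⟩ else 0

variable {χ : Omega S}

theorem germVec_of_val_dom {g : LeftHull S} (h : χ.val (dom g) = true) :
    germVec χ g = delta ⟨germ g χ h, src_germ g χ h⟩ := dif_pos h

theorem germVec_of_not_val_dom {g : LeftHull S} (h : ¬ χ.val (dom g) = true) :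
    germVec χ g = 0 := dif_neg h

theorem exists_germVec_eq_delta (k : SrcFiber (GermGroupoid S) χ) :
    ∃ g, germVec χ g = delta k := by
  obtain ⟨k, hk⟩ := k
  obtain ⟨g, ψ, h, rfl⟩ := exists_germ k
  obtain rfl : ψ = χ := hk
  exact ⟨g, germVec_of_val_dom h⟩

theorem dense_span_germVec (χ : Omega S) :
    Dense (Submodule.span ℂ (Set.range (germVec χ)) : Set (L2 (SrcFiber (GermGroupoid S) χ))) :=
  dense_span_delta.mono <| Submodule.span_mono <| Set.range_subset_iff.2 exists_germVec_eq_delta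

open Classical in
theorem inner_germVec (χ : Omega S) (g h : LeftHull S) :
    inner ℂ (germVec χ g) (germVec χ h) =
      if ∀ᶠ s in χ.near, (g.inv.comp h).1 s = some s then 1 else 0 := by
  simp only [LeftHull.inv_comp_apply_eq_self_iff]
  by_cases hg : χ.val (dom g) = true
  · by_cases hh : χ.val (dom h) = true
    · rw [germVec_of_val_dom hg, germVec_of_val_dom hh, inner_delta, delta_apply]
      refine if_congr ?_ rfl rfl
      rw [Subtype.mk.injEq, germ_eq_iff, and_iff_right rfl]
      refine Filter.eventually_congr ((Omega.near_dom hg).mono fun s ⟨t, ht⟩ => ?_)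
      exact ⟨fun e => ⟨t, ht, e ▸ ht⟩, fun ⟨_, h₁, h₂⟩ => h₁.trans h₂.symm⟩
    · rw [germVec_of_not_val_dom hh, inner_zero_right, if_neg]
      exact fun H => hh (Omega.eventually_mem_iff.1
        (H.mono fun s ⟨t, _, ht⟩ => mem_dom.2 ⟨t, ht⟩))
  · rw [germVec_of_not_val_dom hg, inner_zero_left, if_neg]
    exact fun H => hg (Omega.eventually_mem_iff.1 (H.mono fun s ⟨t, ht, _⟩ => mem_dom.2 ⟨t, ht⟩))

theorem germVec_point_one {g : LeftHull S} {s : S} (h : g.1 1 = some s) :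
    germVec (Omega.point 1) g = delta (baseArrow s) := by
  rw [germVec_of_val_dom ((Omega.val_point _ _).2 (mem_dom.2 ⟨s, h⟩))]
  refine congrArg delta (Subtype.ext ((germ_eq_iff _ _).2 ⟨rfl, .of_forall fun t => ?_⟩))
  exact (by simpa only [one_mul] using g.apply_mul t h : g.1 t = some (s * t))

theorem baseArrow_bijective : Function.Bijective (baseArrow (S := S)) := by
  constructor
  · intro s t h
    have apply_one_eq : (LeftHull.ofElem s).1 1 = (LeftHull.ofElem t).1 1 :=
      Omega.eventually_near_point (p := fun u => (LeftHull.ofElem s).1 u = (LeftHull.ofElem t).1 u)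
        ((germ_eq_iff _ _).1 (congrArg Subtype.val h)).2
    simpa only [mul_one] using (Option.some.inj apply_one_eq : s * 1 = t * 1)
  · rintro ⟨k, hk⟩
    obtain ⟨g, χ, hχ, rfl⟩ := exists_germ k
    obtain rfl : χ = Omega.point 1 := hk
    obtain ⟨s, hs⟩ := mem_dom.1 ((Omega.val_point _ _).1 hχ)
    exact ⟨s, orthonormal_delta.linearIndependent.injective
      ((germVec_point_one hs).symm.trans (germVec_of_val_dom hχ))⟩

theorem opProduct_ext_germVec {a b : OpProduct (SrcFiber (GermGroupoid S) : Omega S → Type _)}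
    (h : ∀ χ g, OpProduct.eval χ a (germVec χ g) = OpProduct.eval χ b (germVec χ g)) : a = b :=
  OpProduct.ext fun χ =>
    ContinuousLinearMap.ext_on (dense_span_germVec χ) (Set.forall_mem_range.2 (h χ))

end GermVec

section Bisection

theorem injOn_src_germSet (g : LeftHull S) :
    Set.InjOn (src : GermGroupoid S → Omega S) (germSet g Set.univ) := by
  rintro _ ⟨χ, -, hχ, rfl⟩ _ ⟨ψ, -, hψ, rfl⟩ (rfl : χ = ψ)
  rfl

theorem act_injective {g : LeftHull S} {χ ψ : Omega S} {hχ : χ.val (dom g) = true}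
    {hψ : ψ.val (dom g) = true} (e : act g χ hχ = act g ψ hψ) : χ = ψ := by
  rw [← act_inv_act hχ, ← act_inv_act hψ]
  simp only [e]

theorem injOn_rng_germSet (g : LeftHull S) :
    Set.InjOn (rng : GermGroupoid S → Omega S) (germSet g Set.univ) := by
  rintro _ ⟨χ, -, hχ, rfl⟩ _ ⟨ψ, -, hψ, rfl⟩ (e : act g χ hχ = act g ψ hψ)
  obtain rfl := act_injective e
  rfl

theorem t2Space_germSet (g : LeftHull S) : T2Space (germSet g (Set.univ : Set (Omega S))) :=
  T2Space.of_injective_continuous (f := fun a : germSet g Set.univ => src a.1)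
    (injOn_src_germSet g).injective (continuous_src.comp continuous_subtype_val)

theorem germSet_eq_image (g : LeftHull S) (C : Set (Omega S)) :
    germSet g C = sec g '' (Subtype.val ⁻¹' C) := by
  ext a
  exact ⟨fun ⟨χ, hC, h, ha⟩ => ⟨⟨χ, h⟩, hC, ha⟩, fun ⟨χ, hC, ha⟩ => ⟨χ.1, hC, χ.2, ha⟩⟩

theorem isClopen_dom (g : LeftHull S) : IsClopen {χ : Omega S | χ.val (dom g) = true} :=
  (isClopen_discrete {true}).preimage (Omega.continuous_val (dom g))

theorem isCompact_germSet (g : LeftHull S) {C : Set (Omega S)} (hC : IsClosed C) :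
    IsCompact (germSet g C) := by
  have : CompactSpace (DomSpace g) :=
    isCompact_iff_compactSpace.1 (isClopen_dom g).isClosed.isCompact
  rw [germSet_eq_image]
  exact (hC.preimage continuous_subtype_val).isCompact.image (continuous_sec g)

open Classical in
/-- The function `φ ∘ src` on `D(g)`, extended by zero. -/
noncomputable def bisectionFun (g : LeftHull S) (φ : C(Omega S, ℂ)) (a : GermGroupoid S) : ℂ :=
  if a ∈ germSet g Set.univ then φ (src a) else 0

theorem bisectionFun_of_mem {g : LeftHull S} (φ : C(Omega S, ℂ)) {a : GermGroupoid S}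
    (ha : a ∈ germSet g Set.univ) : bisectionFun g φ a = φ (src a) := if_pos ha

theorem bisectionFun_of_notMem {g : LeftHull S} (φ : C(Omega S, ℂ)) {a : GermGroupoid S}
    (ha : a ∉ germSet g Set.univ) : bisectionFun g φ a = 0 := if_neg ha

theorem isBasicCc_bisectionFun (g : LeftHull S) (φ : C(Omega S, ℂ)) :
    IsBasicCc (bisectionFun g φ) :=
  ⟨germSet g Set.univ, isOpen_germSet g isOpen_univ, t2Space_germSet g,
    (φ.continuous.comp continuous_src).continuousOn.congr fun _ ha => bisectionFun_of_mem φ ha,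
    germSet g Set.univ, isCompact_germSet g isClosed_univ, subset_rfl,
    fun _ ha => bisectionFun_of_notMem φ ha⟩

/-- The linear map `φ ↦ bisectionFun g φ` with values in `C_c(𝒢(S))`. -/
noncomputable def bisectionCc (g : LeftHull S) : C(Omega S, ℂ) →ₗ[ℂ] Cc (GermGroupoid S) where
  toFun φ := ⟨bisectionFun g φ, Submodule.subset_span (isBasicCc_bisectionFun g φ)⟩
  map_add' φ ψ := Subtype.ext (funext fun a => by
    by_cases h : a ∈ germSet g Set.univ <;> simp [bisectionFun, h])
  map_smul' c φ := Subtype.ext (funext fun a => by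
    by_cases h : a ∈ germSet g Set.univ <;> simp [bisectionFun, h])

theorem norm_regularFamily_bisectionCc_le (g : LeftHull S) (φ : C(Omega S, ℂ)) :
    ‖regularFamily (bisectionCc g φ)‖ ≤ ‖φ‖ := by
  refine norm_regularFamily_le (norm_nonneg φ) (injOn_src_germSet g) (injOn_rng_germSet g)
    (fun a ha => bisectionFun_of_notMem φ ha) fun a => ?_
  change ‖bisectionFun g φ a‖ ≤ ‖φ‖
  by_cases ha : a ∈ germSet g Set.univ
  · rw [bisectionFun_of_mem φ ha]
    exact φ.norm_coe_le_norm _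
  · rw [bisectionFun_of_notMem φ ha, norm_zero]
    exact norm_nonneg φ

/-- The indicator function of the bisection `D(g)`, viewed in `C*_r(𝒢(S))` through the regular
representations. -/
noncomputable def indicatorElem (g : LeftHull S) :
    OpProduct (SrcFiber (GermGroupoid S) : Omega S → Type _) :=
  regularFamily (bisectionCc g 1)

theorem eval_indicatorElem_germVec (χ : Omega S) (g h : LeftHull S) :
    OpProduct.eval χ (indicatorElem g) (germVec χ h) = germVec χ (g.comp h) := by
  by_cases hh : χ.val (dom h) = true
  · rw [germVec_of_val_dom hh]
    by_cases hg : (act h χ hh).val (dom g) = true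
    · have mem : germ g (act h χ hh) hg ∈ germSet g Set.univ := ⟨_, trivial, hg, rfl⟩
      rw [germVec_of_val_dom (comp_mem hh hg)]
      refine (rho_delta_eq_smul (a := germ g (act h χ hh) hg) rfl fun b hb hne => ?_).trans ?_
      · exact bisectionFun_of_notMem 1 fun hbg => hne (injOn_src_germSet g hbg mem hb)
      · change bisectionFun g 1 _ • _ = _
        rw [bisectionFun_of_mem 1 mem, ContinuousMap.one_apply, one_smul]
        exact congrArg delta (Subtype.ext (mul_germ g h χ hh hg))
    · rw [germVec_of_not_val_dom fun H => hg (by rwa [← Omega.val_dom_comp])]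
      refine rho_delta_eq_zero fun b hb => bisectionFun_of_notMem 1 ?_
      rintro ⟨ψ, -, hψ, rfl⟩
      obtain rfl : ψ = act h χ hh := hb
      exact hg hψ
  · rw [germVec_of_not_val_dom hh, germVec_of_not_val_dom fun H => hh (Omega.val_dom_of_comp H),
      map_zero]

theorem indicatorElem_comp (g h : LeftHull S) :
    indicatorElem (g.comp h) = indicatorElem g * indicatorElem h :=
  opProduct_ext_germVec fun χ k => by
    rw [map_mul, mul_apply_eq_comp, eval_indicatorElem_germVec,
      eval_indicatorElem_germVec, eval_indicatorElem_germVec, LeftHull.comp_assoc]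

theorem indicatorElem_inv (g : LeftHull S) : indicatorElem g.inv = star (indicatorElem g) :=
  opProduct_ext_germVec fun χ k => by
    ext j
    obtain ⟨h, hj⟩ := exists_germVec_eq_delta j
    rw [map_star, ContinuousLinearMap.star_eq_adjoint, ← inner_delta, ← inner_delta, ← hj,
      ContinuousLinearMap.adjoint_inner_right, eval_indicatorElem_germVec,
      eval_indicatorElem_germVec, inner_germVec, inner_germVec, LeftHull.inv_comp,
      LeftHull.comp_assoc]

end Bisection

section Regularity

theorem Omega.eventually_mem_or_notMem (χ : Omega S) {A : Set S} (hA : A ∈ barConstructible S) :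
    (∀ᶠ s in χ.near, s ∈ A) ∨ ∀ᶠ s in χ.near, s ∉ A := by
  obtain ⟨X, F, rfl⟩ := hA
  by_cases hX : χ.val X = true
  · by_cases hF : ∃ Y ∈ F, χ.val Y = true
    · obtain ⟨Y, hY, hχY⟩ := hF
      refine .inr ((eventually_mem_iff.2 hχY).mono fun s hs hsA => hsA.2 ?_)
      exact Set.mem_biUnion hY hs
    · push Not at hF
      exact .inl (barOne_mem_near
        ⟨X, F, rfl, hX, fun Y hY => Bool.eq_false_of_not_eq_true (hF Y hY)⟩)
  · exact .inr ((χ.near_iff X).mono fun s hs hsA => hX (hs.1 hsA.1))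

namespace IsCStarRegular

variable (hS : IsCStarRegular S)
include hS

theorem exists_eventually_fixed {χ : Omega S} {R : Finset (LeftHull S)}
    (h : ∀ᶠ s in χ.near, ∃ r ∈ R, r.1 s = some s) : ∃ r ∈ R, ∀ᶠ s in χ.near, r.1 s = some s := by
  obtain ⟨A, hA, hAR⟩ := Omega.exists_barOne h
  have hA_near := Omega.barOne_mem_near hA
  obtain ⟨X, F, rfl, -⟩ := hA
  obtain ⟨l, Y, k, hY, hAY, hYk⟩ := hS R.card (fun k => (R.equivFin.symm k).1) _ ⟨X, F, rfl⟩
    (Filter.nonempty_of_mem hA_near) fun s hs => by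
      obtain ⟨r, hr, hrs⟩ := hAR s hs
      refine Set.mem_iUnion.2 ⟨R.equivFin ⟨r, hr⟩, ?_⟩
      rwa [Set.mem_ofPred_eq, Equiv.symm_apply_apply]
  obtain ⟨j, hj⟩ : ∃ j, ∀ᶠ s in χ.near, s ∈ Y j := by
    by_contra hY_not
    rw [not_exists] at hY_not
    have notMem := Filter.eventually_all.2 fun j =>
      (χ.eventually_mem_or_notMem (hY j)).resolve_left (hY_not j)
    obtain ⟨s, hs, hsA⟩ := (notMem.and hA_near).exists
    exact (Set.mem_iUnion.1 (hAY hsA)).elim hs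
  exact ⟨_, (R.equivFin.symm (k j)).2, hj.mono (hYk j)⟩

theorem exists_generic (χ : Omega S) (R : Finset (LeftHull S)) :
    ∃ s, ∀ r ∈ R, r.1 s = some s ↔ ∀ᶠ u in χ.near, r.1 u = some u := by
  classical
  let moving := R.filter fun r => ¬ ∀ᶠ u in χ.near, r.1 u = some u
  have frequently_moved : ∃ᶠ s in χ.near, ∀ r ∈ moving, r.1 s ≠ some s := fun h => by
    obtain ⟨r, hr, hr_fixed⟩ := hS.exists_eventually_fixed (R := moving) (by simpa using h)
    exact (Finset.mem_filter.1 hr).2 hr_fixed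
  have eventually_fixed : ∀ᶠ s in χ.near, ∀ r ∈ R, (∀ᶠ u in χ.near, r.1 u = some u) →
      r.1 s = some s := by
    simp only [Filter.eventually_all_finset, Filter.eventually_imp_distrib_left]
    exact fun r _ h => h
  obtain ⟨s, hs_moved, hs_fixed⟩ := (frequently_moved.and_eventually eventually_fixed).exists
  refine ⟨s, fun r hr => ⟨fun h => ?_, hs_fixed r hr⟩⟩
  by_contra h_not
  exact hs_moved r (Finset.mem_filter.2 ⟨hr, h_not⟩) h

end IsCStarRegular

end Regularity

section NormEstimate

theorem norm_linearCombination_germVec {χ : Omega S} {s : S} {w : LeftHull S →₀ ℂ}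
    (hs : ∀ g ∈ w.support, ∀ h ∈ w.support,
      (g.inv.comp h).1 s = some s ↔ ∀ᶠ u in χ.near, (g.inv.comp h).1 u = some u) :
    ‖Finsupp.linearCombination ℂ (germVec χ) w‖ =
      ‖Finsupp.linearCombination ℂ
        (fun g => germVec (Omega.point 1) (g.comp (LeftHull.ofElem s))) w‖ := by
  classical
  refine norm_linearCombination_eq_of_inner_eq fun g hg h hh => ?_
  have same_coincidence : (∀ᶠ u in χ.near, (g.inv.comp h).1 u = some u) ↔
      ∀ᶠ u in (Omega.point 1).near, ((g.comp (LeftHull.ofElem s)).inv.comp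
        (h.comp (LeftHull.ofElem s))).1 u = some u := by
    rw [← hs g hg h hh, Omega.eventually_fixed_near_point_one_iff,
      LeftHull.inv_comp_apply_eq_self_iff, LeftHull.inv_comp_apply_eq_self_iff,
      LeftHull.comp_ofElem_apply_one, LeftHull.comp_ofElem_apply_one]
  rw [inner_germVec, inner_germVec]
  exact if_congr same_coincidence rfl rfl

theorem exists_eval_linearCombination
    {a : OpProduct (SrcFiber (GermGroupoid S) : Omega S → Type _)}
    (ha : a ∈ Submodule.span ℂ (Set.range (indicatorElem (S := S)))) (w : LeftHull S →₀ ℂ) :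
    ∃ w' : LeftHull S →₀ ℂ, ∀ χ k,
      OpProduct.eval χ a (Finsupp.linearCombination ℂ (fun h => germVec χ (h.comp k)) w) =
        Finsupp.linearCombination ℂ (fun h => germVec χ (h.comp k)) w' := by
  induction ha using Submodule.span_induction with
  | mem a ha =>
    obtain ⟨g, rfl⟩ := ha
    refine ⟨w.mapDomain g.comp, fun χ k => ?_⟩
    rw [Finsupp.linearCombination_mapDomain]
    refine (Finsupp.apply_linearCombination ℂ
      (OpProduct.eval χ (indicatorElem g)).toLinearMap _ w).trans ?_
    simp only [Function.comp_def, ContinuousLinearMap.coe_coe, eval_indicatorElem_germVec,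
      LeftHull.comp_assoc]
  | zero => exact ⟨0, fun χ k => by simp⟩
  | add a b _ _ iha ihb =>
    obtain ⟨u, hu⟩ := iha
    obtain ⟨v, hv⟩ := ihb
    exact ⟨u + v, fun χ k => by rw [map_add, map_add, ← hu, ← hv]; rfl⟩
  | smul c a _ iha =>
    obtain ⟨u, hu⟩ := iha
    exact ⟨c • u, fun χ k => by rw [map_smul, map_smul, ← hu]; rfl⟩

theorem IsCStarRegular.norm_eval_le (hS : IsCStarRegular S) (χ : Omega S)
    {a : OpProduct (SrcFiber (GermGroupoid S) : Omega S → Type _)}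
    (ha : a ∈ Submodule.span ℂ (Set.range (indicatorElem (S := S)))) :
    ‖OpProduct.eval χ a‖ ≤ ‖OpProduct.eval (Omega.point 1) a‖ := by
  classical
  refine opNorm_le_of_dense_span (dense_span_germVec χ) (norm_nonneg _) fun w => ?_
  obtain ⟨w', hw'⟩ := exists_eval_linearCombination ha w
  have hχ := hw' χ LeftHull.one
  simp only [LeftHull.comp_one] at hχ
  let quotients (v : LeftHull S →₀ ℂ) := Finset.image₂ (fun g h => g.inv.comp h) v.support v.support
  obtain ⟨s, hs⟩ := hS.exists_generic χ (quotients w ∪ quotients w')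
  have hw := norm_linearCombination_germVec (χ := χ) (s := s) (w := w) fun g hg h hh =>
    hs _ (Finset.mem_union_left _ (Finset.mem_image₂_of_mem hg hh))
  have hw'' := norm_linearCombination_germVec (χ := χ) (s := s) (w := w') fun g hg h hh =>
    hs _ (Finset.mem_union_right _ (Finset.mem_image₂_of_mem hg hh))
  rw [hχ, hw, hw'', ← hw']
  exact ContinuousLinearMap.le_opNorm _ _

end NormEstimate

section UnitSpace

/-- The function `χ ↦ χ(p_X)` on `Ω(S)`. -/
noncomputable def valFun (X : Constructible S) : C(Omega S, ℂ) where
  toFun χ := if χ.val X = true then 1 else 0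
  continuous_toFun :=
    (continuous_of_discreteTopology (f := fun b : Bool => if b = true then (1 : ℂ) else 0)).comp
      (Omega.continuous_val X)

theorem valFun_apply (X : Constructible S) (χ : Omega S) :
    valFun X χ = if χ.val X = true then 1 else 0 := rfl

theorem valFun_inter (X Y : Constructible S) : valFun (inter X Y) = valFun X * valFun Y := by
  ext χ
  simp only [ContinuousMap.mul_apply, valFun_apply, Omega.val_inter, Bool.and_eq_true, ite_and,
    ite_mul, one_mul, zero_mul]

theorem valFun_top : valFun (top S) = 1 := by
  ext χ
  rw [valFun_apply, if_pos (Omega.val_top χ), ContinuousMap.one_apply]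

theorem star_valFun (X : Constructible S) : star (valFun X) = valFun X := by
  ext χ
  rw [ContinuousMap.star_apply, valFun_apply, apply_ite star, star_one, star_zero]

theorem dense_span_valFun :
    Dense (Submodule.span ℂ (Set.range (valFun (S := S))) : Set C(Omega S, ℂ)) := by
  have separates : (StarAlgebra.adjoin ℂ (Set.range (valFun (S := S)))).SeparatesPoints := by
    intro χ ψ hne
    obtain ⟨X, hX⟩ : ∃ X, χ.val X ≠ ψ.val X := by
      by_contra! h
      exact hne (Omega.ext h)
    refine ⟨_, ⟨valFun X, StarAlgebra.subset_adjoin ℂ _ ⟨X, rfl⟩, rfl⟩, ?_⟩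
    cases hχ : χ.val X <;> cases hψ : ψ.val X <;> simp_all [valFun_apply]
  have adjoin_eq := starAdjoin_toSubmodule_eq_span (R := ℂ) (s := Set.range (valFun (S := S)))
    ⟨_, valFun_top⟩ (by rintro _ ⟨X, rfl⟩ _ ⟨Y, rfl⟩; exact ⟨_, valFun_inter X Y⟩)
    (by rintro _ ⟨X, rfl⟩; exact ⟨X, (star_valFun X).symm⟩)
  rw [← adjoin_eq]
  exact dense_iff_closure_eq.2 (congrArg SetLike.coe
    (ContinuousMap.starSubalgebra_topologicalClosure_eq_top_of_separatesPoints _ separates))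

instance : TotallyDisconnectedSpace (Semicharacter S) :=
  inferInstanceAs (TotallyDisconnectedSpace {χ : Constructible S → Bool //
    (∃ X, χ X = true) ∧ ∀ X Y, χ (inter X Y) = (χ X && χ Y)})

instance : TotallyDisconnectedSpace (Omega S) :=
  inferInstanceAs (TotallyDisconnectedSpace
    {χ : Semicharacter S // χ ∈ closure (Set.range (charAt (S := S)))})

end UnitSpace

section Spanning

theorem exists_germSet_subset {V : Set (GermGroupoid S)} (hV : IsOpen V) {a : GermGroupoid S}
    (ha : a ∈ V) : ∃ (g : LeftHull S) (C : Set (Omega S)), IsClopen C ∧ a ∈ germSet g C ∧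
      germSet g C ⊆ V := by
  obtain ⟨g, χ, h, rfl⟩ := exists_germ a
  obtain ⟨C, hC, hχ, hCV⟩ := compact_exists_isClopen_in_isOpen
    ((isOpen_dom g).isOpenMap_subtype_val _ (hV.preimage (continuous_sec g)))
    (⟨⟨χ, h⟩, ha, rfl⟩ : χ ∈ Subtype.val '' (sec g ⁻¹' V))
  refine ⟨g, C, hC, ⟨χ, hχ, h, rfl⟩, ?_⟩
  rintro _ ⟨ψ, hψ, h', rfl⟩
  obtain ⟨_, hV', rfl⟩ := hCV hψ
  exact hV'

theorem exists_bisectionFun_eq {V : Set (GermGroupoid S)} {f : GermGroupoid S → ℂ}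
    (hf : ContinuousOn f V) {g : LeftHull S} {C : Set (Omega S)} (hC : IsClopen C)
    (hV : germSet g C ⊆ V) : ∃ φ, bisectionFun g φ = (germSet g C).indicator f := by
  classical
  let C' := C ∩ {χ : Omega S | χ.val (dom g) = true}
  have hC' : IsClopen C' := hC.inter (isClopen_dom g)
  let φ : Omega S → ℂ := fun χ => if h : χ ∈ C' then f (germ g χ h.2) else 0
  have hφ : Continuous φ := by
    have on_C' : ContinuousOn φ C' := by
      rw [continuousOn_iff_continuous_domRestrict]
      have continuous_f_sec : Continuous fun χ : C' => f (sec g ⟨χ.1, χ.2.2⟩) :=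
        hf.comp_continuous ((continuous_sec g).comp (continuous_subtype_val.subtype_mk _))
          fun χ => hV ⟨χ.1, χ.2.1, χ.2.2, rfl⟩
      exact continuous_f_sec.congr fun χ => (show φ χ.1 = _ from dif_pos χ.2).symm
    have on_compl : ContinuousOn φ C'ᶜ := continuousOn_const.congr fun χ hχ => dif_neg hχ
    simpa only [Set.union_compl_self, continuousOn_univ] using
      on_C'.union_of_isOpen on_compl hC'.isOpen hC'.compl.isOpen
  refine ⟨⟨φ, hφ⟩, funext fun a => ?_⟩
  by_cases ha : a ∈ germSet g C
  · rw [Set.indicator_of_mem ha]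
    obtain ⟨χ, hχC, hχ, rfl⟩ := ha
    exact (bisectionFun_of_mem _ ⟨χ, trivial, hχ, rfl⟩).trans (dif_pos ⟨hχC, hχ⟩)
  · rw [Set.indicator_of_notMem ha]
    by_cases hag : a ∈ germSet g Set.univ
    · obtain ⟨χ, -, hχ, rfl⟩ := hag
      exact (bisectionFun_of_mem _ ⟨χ, trivial, hχ, rfl⟩).trans
        (dif_neg fun h => ha ⟨χ, h.1, hχ, rfl⟩)
    · exact bisectionFun_of_notMem _ hag

theorem IsBasicCc.mem_span_bisectionFun {f : GermGroupoid S → ℂ} (hf : IsBasicCc f) :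
    f ∈ Submodule.span ℂ
      (Set.range fun p : LeftHull S × C(Omega S, ℂ) => bisectionFun p.1 p.2) := by
  obtain ⟨V, hV, _, hfV, K, hK, hKV, hfK⟩ := hf
  choose g C hC hmem hCV using fun a : V => exists_germSet_subset hV a.2
  refine mem_of_eq_zero_off_isCompact (W := (Submodule.span ℂ _).toAddSubmonoid)
    (D := fun a => germSet (g a) (C a)) hV (fun a => isOpen_germSet _ (hC a).isOpen)
    (fun a => isCompact_germSet _ (hC a).isClosed) hCV (fun a f hf => ?_) hmem hK hKV hfV hfK
  obtain ⟨φ, hφ⟩ := exists_bisectionFun_eq hf (hC a) (hCV a)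
  exact Submodule.subset_span ⟨(g a, φ), hφ⟩

theorem span_bisectionCc_eq_top :
    Submodule.span ℂ (Set.range fun p : LeftHull S × C(Omega S, ℂ) => bisectionCc p.1 p.2) = ⊤ := by
  refine Submodule.map_injective_of_injective (Cc (GermGroupoid S)).injective_subtype ?_
  rw [Submodule.map_span, ← Set.range_comp, Submodule.map_top, Submodule.range_subtype]
  refine le_antisymm (Submodule.span_le.2 ?_)
    (Submodule.span_le.2 fun _ hf => IsBasicCc.mem_span_bisectionFun hf)
  rintro _ ⟨p, rfl⟩
  exact (bisectionCc p.1 p.2).2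

end Spanning

section Density

/-- The idempotent `p_X` of `I_ℓ(S)`. -/
noncomputable def Constructible.proj (X : Constructible S) : LeftHull S := ⟨idOn X.1, X.2⟩

theorem comp_proj_apply_eq_some {g : LeftHull S} {X : Constructible S} {s t : S} :
    (g.comp X.proj).1 s = some t ↔ g.1 s = some t ∧ s ∈ X.1 := by
  rw [comp_apply_eq_some]
  constructor
  · rintro ⟨u, hu, ht⟩
    obtain ⟨rfl, hX⟩ := idOn_eq_some_iff.1 hu
    exact ⟨ht, hX⟩
  · exact fun ⟨ht, hX⟩ => ⟨s, idOn_eq_some_iff.2 ⟨rfl, hX⟩, ht⟩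

theorem dom_comp_proj (g : LeftHull S) (X : Constructible S) :
    dom (g.comp X.proj) = inter (dom g) X :=
  Subtype.ext <| Set.ext fun s => by
    change s ∈ (dom (g.comp X.proj)).1 ↔ s ∈ (dom g).1 ∧ s ∈ X.1
    simp only [mem_dom, comp_proj_apply_eq_some, exists_and_right]

theorem mem_germSet_comp_proj {g : LeftHull S} {X : Constructible S} {a : GermGroupoid S} :
    a ∈ germSet (g.comp X.proj) Set.univ ↔ a ∈ germSet g Set.univ ∧ (src a).val X = true := by
  have val_dom_iff (χ : Omega S) :
      χ.val (dom (g.comp X.proj)) = true ↔ χ.val (dom g) = true ∧ χ.val X = true := by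
    rw [dom_comp_proj, Omega.val_inter, Bool.and_eq_true]
  have eventually_eq {χ : Omega S} (hX : χ.val X = true) :
      ∀ᶠ s in χ.near, (g.comp X.proj).1 s = g.1 s :=
    (Omega.eventually_mem_iff.2 hX).mono fun s hs => Option.ext fun t => by
      rw [comp_proj_apply_eq_some, and_iff_left hs]
  constructor
  · rintro ⟨χ, -, hχ, rfl⟩
    obtain ⟨hg, hX⟩ := (val_dom_iff χ).1 hχ
    exact ⟨⟨χ, trivial, hg, ((germ_eq_iff _ _).2 ⟨rfl, eventually_eq hX⟩).symm⟩, hX⟩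
  · rintro ⟨⟨χ, -, hχ, rfl⟩, hX : χ.val X = true⟩
    exact ⟨χ, trivial, (val_dom_iff χ).2 ⟨hχ, hX⟩, (germ_eq_iff _ _).2 ⟨rfl, eventually_eq hX⟩⟩

theorem bisectionCc_valFun (g : LeftHull S) (X : Constructible S) :
    bisectionCc g (valFun X) = bisectionCc (g.comp X.proj) 1 := by
  classical
  refine Subtype.ext (funext fun a => ?_)
  change bisectionFun g (valFun X) a = bisectionFun (g.comp X.proj) 1 a
  rw [bisectionFun, bisectionFun, valFun_apply, ContinuousMap.one_apply, ← ite_and]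
  exact if_congr mem_germSet_comp_proj.symm rfl rfl

theorem regularFamily_bisectionCc_mem_closure_span (g : LeftHull S) (φ : C(Omega S, ℂ)) :
    regularFamily (bisectionCc g φ) ∈
      (Submodule.span ℂ (Set.range (indicatorElem (S := S)))).topologicalClosure := by
  let L : C(Omega S, ℂ) →L[ℂ] OpProduct (SrcFiber (GermGroupoid S) : Omega S → Type _) :=
    LinearMap.mkContinuous (regularFamilyₗ (GermGroupoid S) ∘ₗ bisectionCc g) 1 fun φ =>
      (norm_regularFamily_bisectionCc_le g φ).trans_eq (one_mul _).symm
  have span_le : Submodule.span ℂ (Set.range valFun) ≤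
      (Submodule.span ℂ (Set.range (indicatorElem (S := S)))).comap L.toLinearMap := by
    refine Submodule.span_le.2 (Set.range_subset_iff.2 fun X => ?_)
    exact Submodule.subset_span
      ⟨g.comp X.proj, congrArg regularFamily (bisectionCc_valFun g X).symm⟩
  exact map_mem_closure (f := L) L.continuous (dense_span_valFun φ) span_le

theorem adjoin_indicatorElem_toSubmodule :
    (NonUnitalStarAlgebra.adjoin ℂ (Set.range (indicatorElem (S := S)))).toSubmodule =
      Submodule.span ℂ (Set.range (indicatorElem (S := S))) :=
  adjoin_toSubmodule_eq_span
    (by rintro _ ⟨g, rfl⟩ _ ⟨h, rfl⟩; exact ⟨g.comp h, indicatorElem_comp g h⟩)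
    (by rintro _ ⟨g, rfl⟩; exact ⟨g.inv, indicatorElem_inv g⟩)

theorem regularFamily_mem_closure_span (f : Cc (GermGroupoid S)) :
    regularFamily f ∈
      (Submodule.span ℂ (Set.range (indicatorElem (S := S)))).topologicalClosure := by
  have top_le : ⊤ ≤ (Submodule.span ℂ (Set.range indicatorElem)).topologicalClosure.comap
      (regularFamilyₗ (GermGroupoid S)) := by
    rw [← span_bisectionCc_eq_top, Submodule.span_le, Set.range_subset_iff]
    exact fun p => regularFamily_bisectionCc_mem_closure_span p.1 p.2
  exact top_le (Submodule.mem_top (x := f))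

theorem reducedGroupoidAlgebra_eq_closure_adjoin :
    reducedGroupoidAlgebra (GermGroupoid S) =
      (NonUnitalStarAlgebra.adjoin ℂ (Set.range (indicatorElem (S := S)))).topologicalClosure := by
  refine le_antisymm (NonUnitalStarSubalgebra.topologicalClosure_minimal _
    (NonUnitalStarAlgebra.adjoin_le ?_) (NonUnitalStarSubalgebra.isClosed_topologicalClosure _))
    (NonUnitalStarSubalgebra.topologicalClosure_mono (NonUnitalStarAlgebra.adjoin_mono ?_))
  · rintro _ ⟨f, rfl⟩
    have := regularFamily_mem_closure_span f
    rwa [← adjoin_indicatorElem_toSubmodule] at this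
  · rintro _ ⟨g, rfl⟩
    exact ⟨_, rfl⟩

end Density

section Comparison

theorem adjoin_indicatorElem_ofElem :
    NonUnitalStarAlgebra.adjoin ℂ (Set.range fun s : S => indicatorElem (LeftHull.ofElem s)) =
      NonUnitalStarAlgebra.adjoin ℂ (Set.range (indicatorElem (S := S))) := by
  refine le_antisymm (NonUnitalStarAlgebra.adjoin_mono
    (Set.range_comp_subset_range LeftHull.ofElem indicatorElem))
    (NonUnitalStarAlgebra.adjoin_le (Set.range_subset_iff.2 fun ⟨g, hg⟩ => ?_))
  rw [SetLike.mem_coe]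
  induction hg with
  | translation s => exact NonUnitalStarAlgebra.subset_adjoin ℂ _ ⟨s, rfl⟩
  | @trans g h hg hh mem_g mem_h =>
    exact indicatorElem_comp ⟨h, hh⟩ ⟨g, hg⟩ ▸ mul_mem mem_h mem_g
  | @symm g hg mem_g => exact indicatorElem_inv ⟨g, hg⟩ ▸ star_mem mem_g

theorem IsCStarRegular.norm_eval_eq (hS : IsCStarRegular S)
    {a : OpProduct (SrcFiber (GermGroupoid S) : Omega S → Type _)}
    (ha : a ∈ reducedGroupoidAlgebra (GermGroupoid S)) :
    ‖OpProduct.eval (Omega.point 1) a‖ = ‖a‖ := by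
  refine le_antisymm (OpProduct.norm_eval_le _ a) ?_
  rw [reducedGroupoidAlgebra_eq_closure_adjoin] at ha
  refine closure_minimal (t := {a | ‖a‖ ≤ ‖OpProduct.eval (Omega.point 1) a‖}) (fun b hb => ?_)
    (isClosed_le continuous_norm (OpProduct.continuous_eval _).norm) ha
  have mem_span : b ∈ Submodule.span ℂ (Set.range indicatorElem) :=
    adjoin_indicatorElem_toSubmodule.le hb
  exact OpProduct.norm_le (norm_nonneg _) fun χ => hS.norm_eval_le χ mem_span

theorem leftRegular_one : leftRegular (1 : S) = 1 :=
  clm_ext_delta fun t => by rw [leftRegular_delta, one_mul, one_apply_eq_self]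

theorem reducedSemigroupAlgebra_toNonUnitalStarSubalgebra :
    (reducedSemigroupAlgebra S).toNonUnitalStarSubalgebra =
      (NonUnitalStarAlgebra.adjoin ℂ (Set.range (leftRegular (S := S)))).topologicalClosure := by
  set N := NonUnitalStarAlgebra.adjoin ℂ (Set.range (leftRegular (S := S)))
  have one_mem : 1 ∈ N := NonUnitalStarAlgebra.subset_adjoin ℂ _ ⟨1, leftRegular_one⟩
  have adjoin_eq : StarAlgebra.adjoin ℂ (Set.range (leftRegular (S := S))) =
      N.toStarSubalgebra one_mem :=
    le_antisymm (StarAlgebra.adjoin_le (NonUnitalStarAlgebra.subset_adjoin ℂ _))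
      (NonUnitalStarAlgebra.adjoin_le_starAlgebra_adjoin ℂ _)
  rw [reducedSemigroupAlgebra, adjoin_eq]
  rfl

/-- The representation `a ↦ U* ρ_{χ_e}(a) U` of the ambient algebra of `C*_r(𝒢(S))` on `ℓ²(S)`. -/
noncomputable def conjRep (U : L2 S ≃ₗᵢ[ℂ] L2 (SrcFiber (GermGroupoid S) (Omega.point 1))) :
    OpProduct (SrcFiber (GermGroupoid S) : Omega S → Type _) →⋆ₙₐ[ℂ] (L2 S →L[ℂ] L2 S) :=
  (NonUnitalStarAlgHomClass.toNonUnitalStarAlgHom U.symm.conjStarAlgEquiv).comp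
    (OpProduct.eval (Omega.point 1))

variable {U : L2 S ≃ₗᵢ[ℂ] L2 (SrcFiber (GermGroupoid S) (Omega.point 1))}
  (a : OpProduct (SrcFiber (GermGroupoid S) : Omega S → Type _))

theorem conjRep_apply (ξ : L2 S) :
    conjRep U a ξ = U.symm (OpProduct.eval (Omega.point 1) a (U ξ)) := rfl

theorem norm_conjRep : ‖conjRep U a‖ = ‖OpProduct.eval (Omega.point 1) a‖ :=
  NonUnitalStarAlgHom.norm_map _ (EquivLike.injective U.symm.conjStarAlgEquiv) _

theorem continuous_conjRep : Continuous (conjRep U) :=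
  (NonUnitalStarAlgHom.isometry _ (EquivLike.injective U.symm.conjStarAlgEquiv)).continuous.comp
    (OpProduct.continuous_eval _)

variable (hU : ∀ s, U (delta s) = delta (baseArrow s))

include hU

theorem conjRep_indicatorElem_ofElem (s : S) :
    conjRep U (indicatorElem (LeftHull.ofElem s)) = leftRegular s :=
  clm_ext_delta fun t => by
    have germVec_ofElem : germVec (Omega.point 1) (LeftHull.ofElem t) = delta (baseArrow t) :=
      germVec_point_one (congrArg some (mul_one t))
    have germVec_comp : germVec (Omega.point 1) ((LeftHull.ofElem s).comp (LeftHull.ofElem t)) =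
        delta (baseArrow (s * t)) :=
      germVec_point_one (congrArg (fun t => some (s * t)) (mul_one t))
    rw [conjRep_apply, hU, ← germVec_ofElem, eval_indicatorElem_germVec, germVec_comp, ← hU,
      LinearIsometryEquiv.symm_apply_apply, leftRegular_delta]

theorem map_conjRep_adjoin :
    (NonUnitalStarAlgebra.adjoin ℂ (Set.range indicatorElem)).map (conjRep U) =
      NonUnitalStarAlgebra.adjoin ℂ (Set.range (leftRegular (S := S))) := by
  rw [← adjoin_indicatorElem_ofElem, NonUnitalStarAlgHom.map_adjoin, ← Set.range_comp]
  exact congrArg (fun f => NonUnitalStarAlgebra.adjoin ℂ (Set.range f))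
    (funext (conjRep_indicatorElem_ofElem hU))

theorem IsCStarRegular.exists_starAlgEquiv (hS : IsCStarRegular S) :
    ∃ Φ : reducedGroupoidAlgebra (GermGroupoid S) ≃⋆ₐ[ℂ] reducedSemigroupAlgebra S,
      ∀ a, (Φ a : L2 S →L[ℂ] L2 S) = conjRep U a := by
  have norm_map : ∀ a ∈ reducedGroupoidAlgebra (GermGroupoid S), ‖conjRep U a‖ = ‖a‖ :=
    fun a ha => (norm_conjRep a).trans (hS.norm_eval_eq ha)
  have injOn : Set.InjOn (conjRep U) (reducedGroupoidAlgebra (GermGroupoid S)) :=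
    fun a ha b hb hab => by
      rw [← sub_eq_zero, ← norm_eq_zero, ← norm_map _ (sub_mem ha hb), map_sub, hab, sub_self,
        norm_zero]
  refine exists_starAlgEquiv_of_injOn injOn ?_
  rw [reducedGroupoidAlgebra_eq_closure_adjoin] at norm_map ⊢
  rw [map_topologicalClosure_of_norm_map continuous_conjRep norm_map, map_conjRep_adjoin hU,
    reducedSemigroupAlgebra_toNonUnitalStarSubalgebra]

end Comparison

end SemigroupCStar

theorem proposition2p10 {S : Type*} [LeftCancelMonoid S]
    (hS : SemigroupCStar.IsCStarRegular S) :
    ∃ U : SemigroupCStar.L2 S ≃ₗᵢ[ℂ] SemigroupCStar.L2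
        (SemigroupCStar.SrcFiber (SemigroupCStar.GermGroupoid S) (SemigroupCStar.Omega.point 1)),
      (∀ s, U (SemigroupCStar.delta s) = SemigroupCStar.delta (SemigroupCStar.baseArrow s)) ∧
      ∃ Φ : SemigroupCStar.reducedGroupoidAlgebra (SemigroupCStar.GermGroupoid S) ≃⋆ₐ[ℂ]
          SemigroupCStar.reducedSemigroupAlgebra S,
        ∀ (a : SemigroupCStar.reducedGroupoidAlgebra (SemigroupCStar.GermGroupoid S))
          (ξ : SemigroupCStar.L2 S),
          U ((Φ a : SemigroupCStar.L2 S →L[ℂ] SemigroupCStar.L2 S) ξ) =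
            SemigroupCStar.rhoReduced (SemigroupCStar.GermGroupoid S)
              (SemigroupCStar.Omega.point 1) a (U ξ) := by
  obtain ⟨U, hU⟩ := SemigroupCStar.exists_unitary_of_equiv
    (Equiv.ofBijective _ (SemigroupCStar.baseArrow_bijective (S := S)))
  obtain ⟨Φ, hΦ⟩ := hS.exists_starAlgEquiv hU
  refine ⟨U, hU, Φ, fun a ξ => ?_⟩
  rw [hΦ, SemigroupCStar.conjRep_apply, LinearIsometryEquiv.apply_symm_apply]
  rfl
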